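/- All graphs are finite and simple. For a graph $G$, let $\chi'_s(G)$ be the least $k$ such that the edges of $G$ can be colored with $k$ colors so that any two distinct edges that are adjacent, or that are both adjacent to a common edge, receive distinct colors. Let $\mathrm{Mad}(G)$ be the maximum of $2|E(H)|/|V(H)|$ over all subgraphs $H$ of $G$ with at least one vertex (and $0$ if $G$ has no vertices). Let $\Delta\ge 7$ be an integer. Then every graph $G$ with $\mathrm{Mad}(G)<3$ and maximum degree at most $\Delta$ satisfies $\chi'_s(G)\le 3\Delta$. The restriction $\mathrm{Mad}(G)<3$ is sharp, in the sense that it cannot be replaced by $\mathrm{Mad}(G)\le 3$: the graph $K_\Delta(4)$, obtained from the complete graph $K_4$ by adding $\Delta-3$ pendant edges at each of its four vertices, has $\mathrm{Mad}(K_\Delta(4))=3$, maximum degree $\Delta$, and $\chi'_s(K_\Delta(4))=4\Delta-6>3\Delta$. -/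

import Mathlib

namespace StrongEdge

/-- An edge colouring `c` is strong if any two distinct edges that are adjacent (share an endpoint),
or that are both adjacent to a common edge, receive distinct colours. -/
def IsStrongEdgeColoring {V α : Type*} (G : SimpleGraph V) (c : G.edgeSet → α) : Prop :=
  ∀ e₁ e₂ : G.edgeSet, e₁ ≠ e₂ →
    (G.lineGraph.Adj e₁ e₂ ∨ ∃ e₃, G.lineGraph.Adj e₁ e₃ ∧ G.lineGraph.Adj e₂ e₃) →
    c e₁ ≠ c e₂

/-- The strong chromatic index `χ'_s(G)`: the least `k` for which `G` has a strong edge colouring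
with `k` colours (and `⊤` if there is no such `k`, which cannot happen for finite graphs). -/
noncomputable def strongChromaticIndex {V : Type*} (G : SimpleGraph V) : ℕ∞ :=
  ⨅ k ∈ {k : ℕ | ∃ c : G.edgeSet → Fin k, IsStrongEdgeColoring G c}, (k : ℕ∞)

/-- The maximum average degree `Mad(G)` of a finite graph: the maximum of `2|E(H)| / |V(H)|`
over the subgraphs `H` of `G` with at least one vertex (`0` for the graph without vertices). -/
noncomputable def maxAvgDegree {V : Type*} [Finite V] (G : SimpleGraph V) : ℝ :=
  ⨆ H : {H : G.Subgraph // H.verts.Nonempty},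
    2 * (H.1.edgeSet.ncard : ℝ) / (H.1.verts.ncard : ℝ)

/-- The graph `K_Δ(t)`: the complete graph on `t` vertices (the vertices `Sum.inl i`) with
`Δ - t + 1` pendant edges added at each of them (the leaves at `Sum.inl i` are the `Sum.inr (i, j)`).
It is meant for `t ≤ Δ + 1`. -/
def cliqueWithPendants (D t : ℕ) : SimpleGraph (Fin t ⊕ Fin t × Fin (D + 1 - t)) :=
  SimpleGraph.fromRel fun x y =>
    match x, y with
    | Sum.inl _, Sum.inl _ => True
    | Sum.inl i, Sum.inr (j, _) => i = j
    | _, _ => False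

noncomputable instance (D t : ℕ) : DecidableRel (cliqueWithPendants D t).Adj :=
  Classical.decRel _

end StrongEdge

/-! Write `D` for the degree bound and consider a counterexample with fewest edges (`Critical`).
Counting edges at neighbouring vertices shows that `s(a, b)` conflicts with at most as many edges as
the degrees of the other neighbours of `a` and `b` add up to. Two kinds of edges can therefore be
put aside and coloured late, whatever the rest looks like.

Free edges, which join a thin vertex to a vertex of degree at most two, have at most `2 * D + 6 < 3
* D` conflicts and always come last (`ColorableOn.union_freeEdges`). The edges at a starved vertex
`w` can be added to any partial colouring (`Starved.colorableOn_union`). For this the free edges and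
the flexible edges at full neighbours of `w` are erased, the three edges at `w` are coloured so that
around each full neighbour some colour is saved, and the erased edges are put back greedily; the
saving makes this last step fit.

Consequently, in a critical graph a vertex with a leaf, or with a neighbour of degree two leading to
a thin or starved vertex, has neighbours whose degrees sum to about `3 * D` or more
(`Critical.lt_nbrDegSum_of_leaf`, `Critical.le_nbrDegSum_of_bad`), hence several big neighbours.

A discharging argument contradicts sparseness (`Critical.not_sparse`). Let `H` be the set of
vertices of degree at least two, and give `v` in `H` the charge `2 * d - 6`, where `d` is its number
of neighbours in `H`. A vertex neither thin nor starved sends 1 to each neighbour of degree two, and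
2 if that neighbour leads on to a thin or starved vertex. A vertex that is not stingy sends 1 to
each light neighbour. The stingy vertices are those for which this last payment may be unaffordable;
a light vertex with only stingy big neighbours is starved, and so reducible. All final charges are
nonnegative, so `H` spans at least `3 * #H / 2` edges.

For sharpness, any two edges of `K_Δ(4)` conflict, so its index is its number of edges. -/

namespace StrongEdge

open Finset
open scoped Classical

set_option linter.unusedSectionVars false

/-! ### Partial strong colourings and greedy extension. -/

section PartialColorings

variable {V : Type*} [Fintype V] {k : ℕ}

/-- The edges of `G` as a finset. -/
noncomputable def edges (G : SimpleGraph V) : Finset (Sym2 V) := univ.filter (· ∈ G.edgeSet)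

/-- The neighbours of a vertex as a finset. -/
noncomputable def nbrs (G : SimpleGraph V) (x : V) : Finset V := univ.filter (G.Adj x)

/-- The number of neighbours of a vertex. -/
noncomputable def deg (G : SimpleGraph V) (x : V) : ℕ := #(nbrs G x)

/-- The edges in `A` that contain `x`. -/
noncomputable def incident (A : Finset (Sym2 V)) (x : V) : Finset (Sym2 V) := A.filter (x ∈ ·)

/-- Some endpoint of `e` equals or is adjacent to some endpoint of `f`. -/
def Near (G : SimpleGraph V) (e f : Sym2 V) : Prop := ∃ a ∈ e, ∃ b ∈ f, a = b ∨ G.Adj a b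

/-- `c` is a strong colouring of the edges in `A`, with conflicts measured in all of `G`. -/
def ColorsOn (G : SimpleGraph V) (c : Sym2 V → Fin k) (A : Finset (Sym2 V)) : Prop :=
  A ⊆ edges G ∧ ∀ e ∈ A, ∀ f ∈ A, e ≠ f → Near G e f → c e ≠ c f

/-- Some colouring with `k` colours is strong on the edges in `A`. -/
def ColorableOn (G : SimpleGraph V) (k : ℕ) (A : Finset (Sym2 V)) : Prop :=
  ∃ c : Sym2 V → Fin k, ColorsOn G c A

/-- The colours of the edges in `A` that are in conflict with `e`. -/
noncomputable def seen (G : SimpleGraph V) (c : Sym2 V → Fin k) (A : Finset (Sym2 V))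
    (e : Sym2 V) : Finset (Fin k) :=
  (A.filter (Near G e)).image c

variable {G : SimpleGraph V} {A B : Finset (Sym2 V)} {c : Sym2 V → Fin k} {e f : Sym2 V} {a b x y : V}

@[simp] lemma mem_nbrs : y ∈ nbrs G x ↔ G.Adj x y := by simp [nbrs]

@[simp] lemma mem_edges : s(x, y) ∈ edges G ↔ G.Adj x y := by simp [edges]

@[simp] lemma mem_incident : e ∈ incident A x ↔ e ∈ A ∧ x ∈ e := by simp [incident]

lemma Near.symm (h : Near G e f) : Near G f e := by
  obtain ⟨a, ha, b, hb, h⟩ := h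
  exact ⟨b, hb, a, ha, h.imp Eq.symm SimpleGraph.Adj.symm⟩

lemma exists_eq_of_mem_edges (he : e ∈ edges G) (hx : x ∈ e) : ∃ y, G.Adj x y ∧ e = s(x, y) := by
  obtain ⟨y, rfl⟩ := hx
  exact ⟨y, mem_edges.1 he, rfl⟩

lemma ColorsOn.mono (h : ColorsOn G c A) (hB : B ⊆ A) : ColorsOn G c B :=
  ⟨hB.trans h.1, fun e he f hf => h.2 e (hB he) f (hB hf)⟩

lemma ColorableOn.mono (h : ColorableOn G k A) (hB : B ⊆ A) : ColorableOn G k B :=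
  h.imp fun _ hc => hc.mono hB

lemma ColorsOn.update (h : ColorsOn G c A) (he : e ∈ edges G) (heA : e ∉ A) {α : Fin k}
    (hα : α ∉ seen G c A e) : ColorsOn G (Function.update c e α) (insert e A) := by
  have key : ∀ f ∈ A, Near G e f → α ≠ c f := by
    rintro f hf hn rfl
    exact hα (mem_image.2 ⟨f, by simp [hf, hn], rfl⟩)
  have hne : ∀ f ∈ A, f ≠ e := fun f hf h => heA (h ▸ hf)
  refine ⟨insert_subset he h.1, fun f hf g hg hfg hn => ?_⟩
  rcases mem_insert.1 hf with rfl | hf' <;> rcases mem_insert.1 hg with rfl | hg'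
  · exact absurd rfl hfg
  · simpa [Function.update_of_ne (hne g hg')] using key g hg' hn
  · simpa [Function.update_of_ne (hne f hf')] using (key f hf' hn.symm).symm
  · simpa [Function.update_of_ne (hne g hg'), Function.update_of_ne (hne f hf')] using
      h.2 f hf' g hg' hfg hn

lemma exists_notMem_of_card_lt {s : Finset (Fin k)} (h : #s < k) : ∃ α, α ∉ s := by
  by_contra! hs
  have : s = univ := by ext; simp [hs]
  simp [this] at h

/-- Greedy extension that keeps the colours already in use: a set `F` of edges can be coloured if
every edge in it sees at most `k - #F` colours. -/
lemma ColorsOn.exists_extend {F : Finset (Sym2 V)} (hF : F ⊆ edges G) (h : ColorsOn G c A)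
    (hdis : Disjoint F A) (hs : ∀ e ∈ F, #(seen G c A e) + #F ≤ k) :
    ∃ c' : Sym2 V → Fin k, ColorsOn G c' (F ∪ A) ∧ ∀ e ∈ A, c' e = c e := by
  induction F using Finset.induction_on generalizing A c with
  | empty => exact ⟨c, by simpa using h, fun _ _ => rfl⟩
  | insert e F heF ih =>
    have heA : e ∉ A := fun hA => disjoint_left.1 hdis (mem_insert_self e F) hA
    have hcard := card_insert_of_notMem heF
    obtain ⟨α, hα⟩ := exists_notMem_of_card_lt (s := seen G c A e) (by
      have := hs e (mem_insert_self e F); omega)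
    have h' := h.update (hF (mem_insert_self e F)) heA hα
    obtain ⟨c', hc', hcc⟩ := ih ((subset_insert e F).trans hF) h'
      (disjoint_left.2 fun f hf hfA => by
        rcases mem_insert.1 hfA with rfl | hfA
        · exact heF hf
        · exact disjoint_left.1 hdis (mem_insert_of_mem hf) hfA)
      (fun f hf => by
        have h1 := hs f (mem_insert_of_mem hf)
        have h2 : seen G (Function.update c e α) (insert e A) f ⊆ insert α (seen G c A f) := by
          intro β hβ
          obtain ⟨g, hg, rfl⟩ := mem_image.1 hβ
          obtain ⟨hg, hn⟩ := mem_filter.1 hg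
          rcases mem_insert.1 hg with rfl | hg
          · simp
          · have : g ≠ e := fun h => heA (h ▸ hg)
            rw [Function.update_of_ne this]
            exact mem_insert_of_mem (mem_image.2 ⟨g, by simp [hg, hn], rfl⟩)
        have h3 := (card_le_card h2).trans (card_insert_le _ _)
        omega)
    refine ⟨c', hc'.mono ?_, fun f hf => ?_⟩
    · intro f hf
      simp only [mem_union, mem_insert] at hf ⊢
      tauto
    · rw [hcc f (mem_insert_of_mem hf), Function.update_of_ne (fun h : f = e => heA (h ▸ hf))]

/-- If `f` itself passes through `a` or `b`, its other end serves as the neighbour. Thus conflicts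
can be counted through the edges at neighbours alone. -/
lemma exists_mem_of_near (hab : G.Adj a b) (hf : f ∈ edges G) (hne : f ≠ s(a, b))
    (hn : Near G s(a, b) f) : ∃ x ∈ f, (G.Adj a x ∧ x ≠ b) ∨ (G.Adj b x ∧ x ≠ a) := by
  have main : ∀ a b : V, f ≠ s(a, b) → ∀ q ∈ f, (a = q ∨ G.Adj a q) →
      ∃ x ∈ f, (G.Adj a x ∧ x ≠ b) ∨ (G.Adj b x ∧ x ≠ a) := by
    intro a b hne q hq h
    rcases h with rfl | h
    · obtain ⟨y, hy, rfl⟩ := exists_eq_of_mem_edges hf hq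
      exact ⟨y, by simp, Or.inl ⟨hy, fun h => hne (by rw [h])⟩⟩
    · by_cases hqb : q = b
      · subst hqb
        obtain ⟨y, hy, rfl⟩ := exists_eq_of_mem_edges hf hq
        exact ⟨y, by simp, Or.inr ⟨hy, fun h => hne (by rw [h, Sym2.eq_swap])⟩⟩
      · exact ⟨q, hq, Or.inl ⟨h, hqb⟩⟩
  obtain ⟨p, hp, q, hq, h⟩ := hn
  rcases Sym2.mem_iff.1 hp with rfl | rfl
  · exact main _ _ hne q hq h
  · obtain ⟨x, hx, h⟩ := main _ _ (by rwa [Sym2.eq_swap]) q hq h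
    exact ⟨x, hx, h.symm⟩

lemma incident_card_le (hA : A ⊆ edges G) :
    #(incident A x) ≤ #((nbrs G x).filter fun y => s(x, y) ∈ A) := by
  refine (card_le_card (t := ((nbrs G x).filter fun y => s(x, y) ∈ A).image (s(x, ·))) ?_).trans
    card_image_le
  intro e he
  obtain ⟨he, hx⟩ := mem_incident.1 he
  obtain ⟨y, hy, rfl⟩ := exists_eq_of_mem_edges (hA he) hx
  exact mem_image.2 ⟨y, by simp [hy, he], rfl⟩

lemma incident_card_le_deg (hA : A ⊆ edges G) : #(incident A x) ≤ deg G x :=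
  (incident_card_le hA).trans (card_le_card (filter_subset _ _))

/-- The edges in `A` that contain a vertex of `s`. -/
noncomputable def touching (A : Finset (Sym2 V)) (s : Finset V) : Finset (Sym2 V) :=
  s.biUnion (incident A)

lemma mem_touching {s : Finset V} : e ∈ touching A s ↔ e ∈ A ∧ ∃ x ∈ s, x ∈ e := by
  simp only [touching, mem_biUnion, mem_incident]
  tauto

lemma touching_card_le (s : Finset V) : #(touching A s) ≤ ∑ x ∈ s, #(incident A x) :=
  card_biUnion_le

lemma seen_card_le (hab : G.Adj a b) (hA : A ⊆ edges G) (he : s(a, b) ∉ A) :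
    #(seen G c A s(a, b)) ≤
      ∑ x ∈ (nbrs G a).erase b, #(incident A x) + ∑ x ∈ (nbrs G b).erase a, #(incident A x) := by
  refine card_image_le.trans ((card_le_card
    (t := touching A ((nbrs G a).erase b) ∪ touching A ((nbrs G b).erase a)) ?_).trans
    ((card_union_le _ _).trans (add_le_add (touching_card_le _) (touching_card_le _))))
  intro f hf
  obtain ⟨hf, hn⟩ := mem_filter.1 hf
  obtain ⟨x, hx, h⟩ := exists_mem_of_near hab (hA hf) (fun h => he (h ▸ hf)) hn
  simp only [mem_union, mem_touching, mem_erase, mem_nbrs]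
  rcases h with h | h
  · exact Or.inl ⟨hf, x, ⟨h.2, h.1⟩, hx⟩
  · exact Or.inr ⟨hf, x, ⟨h.2, h.1⟩, hx⟩

lemma ColorableOn.insert (h : ColorableOn G k A) (hab : G.Adj a b) (he : s(a, b) ∉ A)
    (hs : ∑ x ∈ (nbrs G a).erase b, #(incident A x) +
      ∑ x ∈ (nbrs G b).erase a, #(incident A x) < k) : ColorableOn G k (insert s(a, b) A) := by
  obtain ⟨c, hc⟩ := h
  obtain ⟨α, hα⟩ := exists_notMem_of_card_lt ((seen_card_le (c := c) hab hc.1 he).trans_lt hs)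
  exact ⟨_, hc.update (mem_edges.2 hab) he hα⟩

/-- Edges with fewer than `k` conflicts in all of `G` can always be coloured last. -/
lemma ColorableOn.union_of_few_conflicts (h : ColorableOn G k A) {F : Finset (Sym2 V)}
    (hF : ∀ e ∈ F, ∃ a b, e = s(a, b) ∧ G.Adj a b ∧
      ∑ x ∈ (nbrs G a).erase b, deg G x + ∑ x ∈ (nbrs G b).erase a, deg G x < k) :
    ColorableOn G k (F ∪ A) := by
  induction F using Finset.induction_on with
  | empty => simpa using h
  | insert e F _ ih =>
    have ih := ih fun f hf => hF f (mem_insert_of_mem hf)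
    obtain ⟨a, b, rfl, hab, hk⟩ := hF e (mem_insert_self e F)
    rw [insert_union]
    by_cases he : s(a, b) ∈ F ∪ A
    · rwa [insert_eq_of_mem he]
    · have hA := ih.choose_spec.1
      refine ih.insert hab he (lt_of_le_of_lt (add_le_add ?_ ?_) hk) <;>
        exact sum_le_sum fun x _ => incident_card_le_deg hA

end PartialColorings

/-! ### Choosing the three colours at a starved vertex. -/

section ColorChoice

variable {D : ℕ}

lemma exists_color_insert_card_le {Y T : Finset (Fin (3 * D))} (hY : #Y ≤ 2 * D + 2)
    (hT : #T ≤ 2 * D + 1) (hD : 2 ≤ D) : ∃ μ, μ ∉ T ∧ #(insert μ Y) ≤ 2 * D + 2 := by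
  by_cases h : #Y ≤ 2 * D + 1
  · obtain ⟨μ, hμ⟩ := exists_notMem_of_card_lt (s := T) (by omega)
    exact ⟨μ, hμ, (card_insert_le _ _).trans (by omega)⟩
  -- Here `Y` has exactly `2 * D + 2` colours, so `T` and the complement of `Y` together miss at
  -- least one of the `3 * D` colours. A colour already in `Y` costs nothing.
  · have h1 := card_compl_add_card Y
    have h2 := card_union_le T Yᶜ
    rw [Fintype.card_fin] at h1
    obtain ⟨μ, hμ⟩ := exists_notMem_of_card_lt (s := T ∪ Yᶜ) (by omega)
    simp only [mem_union, mem_compl, not_or, not_not] at hμ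
    exact ⟨μ, hμ.1, by rwa [insert_eq_of_mem hμ.2]⟩

/-- One saved colour is needed on each of two sides. Either `ζ` can be spent on `X` and `μ` on `X'`,
or the obstruction to this forces the two sides to overlap so much that `μ` alone serves both. -/
lemma exists_two_colors_both {γ : Fin (3 * D)} {X X' M M' N W : Finset (Fin (3 * D))} (hD : 7 ≤ D)
    (hX : #X ≤ 2 * D) (hX' : #X' ≤ 2 * D) (hN : #N ≤ 1) (hW : #W ≤ D) (hM : #M ≤ 2)
    (hM' : #M' ≤ 2) :
    ∃ ζ μ, ζ ∉ insert γ (X' ∪ M ∪ N) ∧ μ ∉ insert γ (insert ζ (W ∪ M ∪ M')) ∧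
      #(insert μ (insert ζ (insert γ X))) ≤ 2 * D + 2 ∧
      #(insert μ (insert ζ (insert γ X'))) ≤ 2 * D + 2 := by
  have hY := card_insert_le γ X
  have hY' := card_insert_le γ X'
  have hT := card_insert_le γ (X' ∪ M ∪ N)
  have hT2 := card_union_le (X' ∪ M) N
  have hT3 := card_union_le X' M
  have hWM := card_union_le W M
  have hWMM := card_union_le (W ∪ M) M'
  by_cases h : ∃ ζ, ζ ∉ insert γ (X' ∪ M ∪ N) ∧ #(insert ζ (insert γ X)) ≤ 2 * D + 1
  · obtain ⟨ζ, hζ, hcard⟩ := h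
    have h1 := card_insert_le ζ (insert γ X')
    have h2 := card_insert_le γ (insert ζ (W ∪ M ∪ M'))
    have h3 := card_insert_le ζ (W ∪ M ∪ M')
    obtain ⟨μ, hμ, hc⟩ := exists_color_insert_card_le (Y := insert ζ (insert γ X'))
      (T := insert γ (insert ζ (W ∪ M ∪ M'))) (by omega) (by omega) (by omega)
    exact ⟨ζ, μ, hζ, hμ, (card_insert_le _ _).trans (by omega), hc⟩
  -- No admissible `ζ` helps `X`, so `insert γ X` has `2 * D + 1` elements, all lying in `insert γ
  -- (X' ∪ M ∪ N)`. A colour `μ` of `insert γ X` other than `γ` and outside `M` and `N` then lies in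
  -- `X'` as well; this is why `N` is also avoided below.
  · push Not at h
    obtain ⟨ζ, hζ⟩ := exists_notMem_of_card_lt (s := insert γ (X' ∪ M ∪ N)) (by omega)
    have hbig : ∀ ξ, ξ ∉ insert γ (X' ∪ M ∪ N) → ξ ∉ insert γ X := fun ξ hξ hm => by
      have := h ξ hξ
      rw [insert_eq_of_mem hm] at this
      omega
    have hYc : #(insert γ X)ᶜ ≤ D - 1 := by
      have h1 := card_compl_add_card (insert γ X)
      have h2 := h ζ hζ
      have h3 := card_insert_le ζ (insert γ X)
      rw [Fintype.card_fin] at h1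
      omega
    have h4 := card_union_le (insert γ (W ∪ M ∪ M') ∪ N) (insert γ X)ᶜ
    have h5 := card_union_le (insert γ (W ∪ M ∪ M')) N
    have h6 := card_insert_le γ (W ∪ M ∪ M')
    obtain ⟨μ, hμ⟩ := exists_notMem_of_card_lt
      (s := insert γ (W ∪ M ∪ M') ∪ N ∪ (insert γ X)ᶜ) (by omega)
    have hμX : μ ∈ insert γ X := by
      by_contra hc
      exact hμ (mem_union_right _ (mem_compl.2 hc))
    have hμX' : μ ∈ insert γ X' := by
      by_contra hc
      refine hbig μ (fun hm => ?_) hμX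
      simp only [mem_union, mem_insert, mem_compl, not_or] at hm hμ hc
      tauto
    have h7 := card_insert_le ζ (insert γ X)
    have h8 := card_insert_le ζ (insert γ X')
    refine ⟨ζ, μ, hζ, fun hm => ?_, ?_, ?_⟩
    · have hne : μ ≠ ζ := fun heq => hbig ζ hζ (heq ▸ hμX)
      simp only [mem_union, mem_insert, mem_compl, not_or] at hm hμ
      tauto
    · rw [insert_eq_of_mem (mem_insert_of_mem hμX)]
      omega
    · rw [insert_eq_of_mem (mem_insert_of_mem hμX')]
      omega

/-- Three colours `γ`, `ζ`, `μ` that avoid prescribed sets, of which at least one is wasted on the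
set `X` if `F` holds and on the set `X'` if `F'` holds. -/
lemma exists_three_colors {X X' M M' N W : Finset (Fin (3 * D))} (F F' : Prop) (hD : 7 ≤ D)
    (hX : #X ≤ 2 * D) (hX' : #X' ≤ 2 * D) (hN : #N ≤ 1) (hW : #W ≤ D) (hM : #M ≤ 4)
    (hM' : #M' ≤ 4) (hMF : F → #M ≤ 2) (hMF' : F' → #M' ≤ 2) :
    ∃ γ ζ μ, γ ∉ X ∪ M' ∪ N ∧ ζ ∉ insert γ (X' ∪ M ∪ N) ∧ μ ∉ insert γ (insert ζ (W ∪ M ∪ M')) ∧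
      (F → #(insert μ (insert ζ (insert γ X))) ≤ 2 * D + 2) ∧
      (F' → #(insert μ (insert ζ (insert γ X'))) ≤ 2 * D + 2) := by
  have h1 := card_union_le (X ∪ M') N
  have h2 := card_union_le X M'
  obtain ⟨γ, hγ⟩ := exists_notMem_of_card_lt (s := X ∪ M' ∪ N) (by omega)
  by_cases hFF : F ∧ F'
  · obtain ⟨ζ, μ, hζ, hμ, h, h'⟩ :=
      exists_two_colors_both (γ := γ) hD hX hX' hN hW (hMF hFF.1) (hMF' hFF.2)
    exact ⟨γ, ζ, μ, hγ, hζ, hμ, fun _ => h, fun _ => h'⟩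
  have hT := card_insert_le γ (X' ∪ M ∪ N)
  have hT2 := card_union_le (X' ∪ M) N
  have hT3 := card_union_le X' M
  -- At most `1 + 2 * D + 4 + 1` colours are excluded, which is below `3 * D` because `7 ≤ D`.
  obtain ⟨ζ, hζ⟩ := exists_notMem_of_card_lt (s := insert γ (X' ∪ M ∪ N)) (by omega)
  have hWM := card_union_le W M
  have hWMM := card_union_le (W ∪ M) M'
  have h2 := card_insert_le γ (insert ζ (W ∪ M ∪ M'))
  have h3 := card_insert_le ζ (W ∪ M ∪ M')
  have choice : ∀ Y : Finset (Fin (3 * D)), #Y ≤ 2 * D → (F ∨ F') →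
      ∃ μ, μ ∉ insert γ (insert ζ (W ∪ M ∪ M')) ∧ 
        #(insert μ (insert ζ (insert γ Y))) ≤ 2 * D + 2 := by
    intro Y hY hF
    have h4 := card_insert_le ζ (insert γ Y)
    have h5 := card_insert_le γ Y
    refine exists_color_insert_card_le (by omega) ?_ (by omega)
    rcases hF with hF | hF
    · have := hMF hF
      omega
    · have := hMF' hF
      omega
  by_cases hF : F
  · obtain ⟨μ, hμ, hc⟩ := choice X hX (Or.inl hF)
    exact ⟨γ, ζ, μ, hγ, hζ, hμ, fun _ => hc, fun hF' => absurd ⟨hF, hF'⟩ hFF⟩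
  by_cases hF' : F'
  · obtain ⟨μ, hμ, hc⟩ := choice X' hX' (Or.inr hF')
    exact ⟨γ, ζ, μ, hγ, hζ, hμ, fun h => absurd h hF, fun _ => hc⟩
  · obtain ⟨μ, hμ⟩ := exists_notMem_of_card_lt
      (s := insert γ (insert ζ (W ∪ M ∪ M'))) (by omega)
    exact ⟨γ, ζ, μ, hγ, hζ, hμ, fun h => absurd h hF, fun h => absurd h hF'⟩

end ColorChoice

/-! ### Vertex types, free edges and flexible edges. -/

section VertexTypes

variable {V : Type*} [Fintype V]

/-- The neighbours of degree at least three. -/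
noncomputable def bigNbrs (G : SimpleGraph V) (v : V) : Finset V :=
  (nbrs G v).filter fun x => 3 ≤ deg G x

/-- The neighbours of degree two. -/
noncomputable def twoNbrs (G : SimpleGraph V) (v : V) : Finset V :=
  (nbrs G v).filter fun x => deg G x = 2

/-- The neighbours of degree one. -/
noncomputable def leafNbrs (G : SimpleGraph V) (v : V) : Finset V :=
  (nbrs G v).filter fun x => deg G x = 1

/-- The sum of the degrees of the neighbours. -/
noncomputable def nbrDegSum (G : SimpleGraph V) (v : V) : ℕ := ∑ x ∈ nbrs G v, deg G x

/-- A vertex of degree at most five with at most one neighbour of degree at least three. -/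
def Thin (G : SimpleGraph V) (w : V) : Prop := #(bigNbrs G w) ≤ 1 ∧ deg G w ≤ 5

/-- The neighbours of degree two whose other neighbour is thin. -/
noncomputable def thinNbrs (G : SimpleGraph V) (v : V) : Finset V :=
  (twoNbrs G v).filter fun u => ∃ w, G.Adj u w ∧ w ≠ v ∧ Thin G w

/-- A vertex of degree three with exactly one neighbour of degree two and no leaves. -/
def Light (G : SimpleGraph V) (w : V) : Prop :=
  deg G w = 3 ∧ #(bigNbrs G w) = 2 ∧ #(twoNbrs G w) = 1

/-- The light neighbours. -/
noncomputable def lightNbrs (G : SimpleGraph V) (v : V) : Finset V := (nbrs G v).filter (Light G)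

/-- Three neighbours of degree at least three, one of which is light, and all neighbours of degree
two lead to thin vertices. -/
def Full (G : SimpleGraph V) (y : V) : Prop :=
  #(bigNbrs G y) = 3 ∧ #(lightNbrs G y) = 1 ∧ twoNbrs G y ⊆ thinNbrs G y

/-- The vertices that cannot afford to support a light neighbour. -/
def Stingy (G : SimpleGraph V) (D : ℕ) (y : V) : Prop :=
  (deg G y ≤ 5 ∧ nbrDegSum G y ≤ 2 * D + 3) ∨ Full G y

/-- A light vertex without supporting neighbours. -/
def Starved (G : SimpleGraph V) (D : ℕ) (w : V) : Prop :=
  Light G w ∧ ∀ y ∈ bigNbrs G w, Stingy G D y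

/-- The neighbours of degree two whose other neighbour is starved. -/
noncomputable def starvedNbrs (G : SimpleGraph V) (D : ℕ) (v : V) : Finset V :=
  (twoNbrs G v).filter fun u => ∃ w, G.Adj u w ∧ w ≠ v ∧ Starved G D w

/-- The edges from a thin vertex to a vertex of degree at most two. -/
noncomputable def freeEdges (G : SimpleGraph V) : Finset (Sym2 V) :=
  (edges G).filter fun e => ∃ x w, e = s(x, w) ∧ Thin G w ∧ deg G x ≤ 2

/-- The edges from `y` to vertices of degree at most two. -/
noncomputable def flexEdges (G : SimpleGraph V) (y : V) : Finset (Sym2 V) :=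
  (edges G).filter fun e => ∃ q, e = s(y, q) ∧ deg G q ≤ 2

variable {G : SimpleGraph V} {D : ℕ} {A : Finset (Sym2 V)} {u v w x y z : V}

@[simp] lemma mem_bigNbrs : x ∈ bigNbrs G v ↔ G.Adj v x ∧ 3 ≤ deg G x := by simp [bigNbrs]

@[simp] lemma mem_twoNbrs : x ∈ twoNbrs G v ↔ G.Adj v x ∧ deg G x = 2 := by simp [twoNbrs]

@[simp] lemma mem_leafNbrs : x ∈ leafNbrs G v ↔ G.Adj v x ∧ deg G x = 1 := by simp [leafNbrs]

@[simp] lemma mem_lightNbrs : x ∈ lightNbrs G v ↔ G.Adj v x ∧ Light G x := by simp [lightNbrs]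

lemma mem_thinNbrs : u ∈ thinNbrs G v ↔
    (G.Adj v u ∧ deg G u = 2) ∧ ∃ w, G.Adj u w ∧ w ≠ v ∧ Thin G w := by simp [thinNbrs]

lemma mem_starvedNbrs : u ∈ starvedNbrs G D v ↔
    (G.Adj v u ∧ deg G u = 2) ∧ ∃ w, G.Adj u w ∧ w ≠ v ∧ Starved G D w := by simp [starvedNbrs]

lemma nbrs_eq_pair (hu : deg G u = 2) (hv : G.Adj u v) (hw : G.Adj u w) (hne : w ≠ v) :
    nbrs G u = {v, w} := by
  symm
  apply eq_of_subset_of_card_le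
  · intro x hx
    rcases mem_insert.1 hx with rfl | hx
    · simpa
    · simpa [mem_singleton.1 hx]
  · rw [card_pair hne.symm]
    exact hu.le

lemma deg_pos_of_adj (h : G.Adj x y) : 1 ≤ deg G x :=
  card_pos.2 ⟨y, by simpa⟩

lemma deg_eq_add : deg G v = #(leafNbrs G v) + #(twoNbrs G v) + #(bigNbrs G v) := by
  rw [deg, leafNbrs, twoNbrs, bigNbrs, ← card_union_of_disjoint, ← card_union_of_disjoint]
  · congr 1
    ext x
    simp only [mem_nbrs, mem_union, mem_filter]
    constructor
    · intro h
      have := deg_pos_of_adj h.symm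
      have : deg G x = 1 ∨ deg G x = 2 ∨ 3 ≤ deg G x := by omega
      tauto
    · tauto
  · rw [disjoint_left]
    intro x hx hx'
    simp only [mem_union, mem_filter] at hx hx'
    omega
  · rw [disjoint_left]
    intro x hx hx'
    simp only [mem_filter] at hx hx'
    omega

lemma mem_freeEdges (h : G.Adj x w) (hw : Thin G w) (hx : deg G x ≤ 2) : s(x, w) ∈ freeEdges G := by
  simp only [freeEdges, mem_filter, mem_edges]
  exact ⟨h, x, w, rfl, hw, hx⟩

lemma mem_flexEdges (h : G.Adj y x) (hx : deg G x ≤ 2) : s(y, x) ∈ flexEdges G y := by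
  simp only [flexEdges, mem_filter, mem_edges]
  exact ⟨h, x, rfl, hx⟩

lemma nbrDegSum_erase (h : G.Adj v u) :
    ∑ x ∈ (nbrs G v).erase u, deg G x + deg G u = nbrDegSum G v :=
  sum_erase_add _ _ (by simpa)

/-- The end of degree at most two contributes at most `D` conflicts. The thin end has at most four
other neighbours, all but one of degree at most two. -/
lemma ColorableOn.union_freeEdges (hD : 7 ≤ D) (hdeg : ∀ x, deg G x ≤ D)
    (h : ColorableOn G (3 * D) A) : ColorableOn G (3 * D) (freeEdges G ∪ A) := by
  refine h.union_of_few_conflicts fun e he => ?_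
  obtain ⟨he, x, w, rfl, hw, hx⟩ := mem_filter.1 he
  have hxw := mem_edges.1 he
  refine ⟨x, w, rfl, hxw, ?_⟩
  have h1 : ∑ z ∈ (nbrs G x).erase w, deg G z ≤ D := by
    refine (sum_le_card_nsmul _ _ D fun z _ => hdeg z).trans ?_
    have : #((nbrs G x).erase w) ≤ 1 := by
      rw [card_erase_of_mem (by simpa)]
      change deg G x - 1 ≤ 1
      omega
    simpa using Nat.mul_le_mul_right D this
  have h2 : ∑ z ∈ (nbrs G w).erase x, deg G z ≤ 2 * 4 + (D - 2) := by
    calc ∑ z ∈ (nbrs G w).erase x, deg G z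
        ≤ ∑ z ∈ (nbrs G w).erase x, (2 + if 3 ≤ deg G z then D - 2 else 0) := by
          refine sum_le_sum fun z _ => ?_
          have := hdeg z
          split_ifs <;> omega
      _ = 2 * #((nbrs G w).erase x) + (D - 2) * #(((nbrs G w).erase x).filter (3 ≤ deg G ·)) := by
          rw [sum_add_distrib, ← sum_filter, sum_const, sum_const, smul_eq_mul, smul_eq_mul]
          ring
      _ ≤ 2 * 4 + (D - 2) * 1 := by
          gcongr
          · rw [card_erase_of_mem (by simpa using hxw.symm)]
            have := hw.2
            change deg G w - 1 ≤ 4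
            omega
          · exact (card_le_card (filter_subset_filter _ (erase_subset _ _))).trans hw.1
      _ = 2 * 4 + (D - 2) := by ring
  -- The total `D + (8 + (D - 2)) = 2 * D + 6` is below `3 * D` exactly when `7 ≤ D`.
  omega

/-- A thin vertex is in at most one edge that is not free. -/
lemma Thin.incident_card_le (hw : Thin G w) (hA : A ⊆ edges G) (hfree : Disjoint A (freeEdges G)) :
    #(incident A w) ≤ 1 := by
  refine (StrongEdge.incident_card_le hA).trans ((card_le_card fun x hx => ?_).trans hw.1)
  obtain ⟨hx, he⟩ := mem_filter.1 hx
  rw [mem_nbrs] at hx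
  refine mem_bigNbrs.2 ⟨hx, ?_⟩
  by_contra hlt
  refine disjoint_left.1 hfree he ?_
  rw [Sym2.eq_swap]
  exact mem_freeEdges hx.symm hw (by omega)

lemma flexEdges_subset : flexEdges G y ⊆ edges G := filter_subset _ _

lemma flexEdges_card_le : #(flexEdges G y) + #(bigNbrs G y) ≤ deg G y := by
  have h : #(flexEdges G y) ≤ #((nbrs G y).filter fun x => ¬ 3 ≤ deg G x) := by
    refine (card_le_card (t := ((nbrs G y).filter fun x => ¬ 3 ≤ deg G x).image (s(y, ·)))
      ?_).trans card_image_le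
    intro e he
    obtain ⟨he, q, rfl, hq⟩ := mem_filter.1 he
    exact mem_image.2 ⟨q, by simpa using ⟨mem_edges.1 he, by omega⟩, rfl⟩
  have := card_filter_add_card_filter_not (s := nbrs G y) (fun x => 3 ≤ deg G x)
  rw [deg, bigNbrs]
  omega

/-- Without free edges and flexible edges, the small neighbours of a full vertex meet no edges. -/
lemma Full.incident_eq_empty (hy : Full G y) (hA : A ⊆ edges G) (hfree : Disjoint A (freeEdges G))
    (hflex : Disjoint A (flexEdges G y)) (hx : G.Adj y x) (hx3 : deg G x ≤ 2) :
    incident A x = ∅ := by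
  rw [eq_empty_iff_forall_notMem]
  intro e he
  obtain ⟨he, hxe⟩ := mem_incident.1 he
  obtain ⟨w', hw', rfl⟩ := exists_eq_of_mem_edges (hA he) hxe
  by_cases hw'y : w' = y
  · subst hw'y
    exact disjoint_left.1 hflex he (by rw [Sym2.eq_swap]; exact mem_flexEdges hx hx3)
  have h2 : deg G x = 2 := by
    have : 1 < deg G x := one_lt_card.2 ⟨w', by simpa, y, by simpa using hx.symm, hw'y⟩
    omega
  obtain ⟨-, w, hxw, hwy, hw⟩ := mem_thinNbrs.1 (hy.2.2 (mem_twoNbrs.2 ⟨hx, h2⟩))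
  have : w' = w := by
    have := nbrs_eq_pair h2 hx.symm hxw hwy
    have h3 : w' ∈ nbrs G x := by simpa
    rw [this] at h3
    simpa [hw'y] using h3
  subst this
  exact disjoint_left.1 hfree he (mem_freeEdges hw' hw hx3)

/-- The flexible edges at a full vertex can be coloured last if the edges around its big
neighbours use few colours. -/
lemma Full.exists_extend {c : Sym2 V → Fin (3 * D)} (hdeg : ∀ x, deg G x ≤ D)
    (hy : Full G y) (hc : ColorsOn G c A) (hfree : Disjoint A (freeEdges G))
    (hflex : Disjoint A (flexEdges G y))
    (hcard : #((touching A (bigNbrs G y)).image c) ≤ 2 * D + 2) :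
    ∃ c' : Sym2 V → Fin (3 * D), ColorsOn G c' (flexEdges G y ∪ A) ∧ ∀ e ∈ A, c' e = c e := by
  refine hc.exists_extend flexEdges_subset hflex.symm fun e he => ?_
  have hF := flexEdges_card_le (G := G) (y := y)
  have hyD := hdeg y
  rw [hy.1] at hF
  -- Three neighbours are big, so there are at most `D - 3` flexible edges. The bound splits as `2 *
  -- D + 2` colours around the big neighbours and one for the only non-free edge at a thin vertex
  -- beyond `q`.
  suffices h : #(seen G c A e) ≤ 2 * D + 3 by omega
  obtain ⟨heG, q, rfl, hq⟩ := mem_filter.1 he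
  have hyq := mem_edges.1 heG
  have hsub : ∃ s : Finset (Sym2 V), #s ≤ 1 ∧ 
      seen G c A s(y, q) ⊆ (touching A (bigNbrs G y)).image c ∪ s.image c := by
    have main : ∀ f ∈ A, Near G s(y, q) f → (∃ x ∈ bigNbrs G y, x ∈ f) ∨
        ∃ x ∈ f, G.Adj q x ∧ x ≠ y := by
      intro f hf hn
      obtain ⟨x, hxf, h | h⟩ := exists_mem_of_near hyq (hc.1 hf)
        (fun h => disjoint_left.1 hflex hf (h ▸ he)) hn
      · by_cases hx : 3 ≤ deg G x
        · exact Or.inl ⟨x, by simp [h.1, hx], hxf⟩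
        · have := hy.incident_eq_empty hc.1 hfree hflex h.1 (by omega)
          exact absurd (mem_incident.2 ⟨hf, hxf⟩) (by simp [this])
      · exact Or.inr ⟨x, hxf, h⟩
    by_cases hq2 : deg G q = 2
    · obtain ⟨-, w, hqw, hwy, hw⟩ := mem_thinNbrs.1 (hy.2.2 (mem_twoNbrs.2 ⟨hyq, hq2⟩))
      refine ⟨incident A w, hw.incident_card_le hc.1 hfree, fun α hα => ?_⟩
      obtain ⟨f, hf, rfl⟩ := mem_image.1 hα
      obtain ⟨hf, hn⟩ := mem_filter.1 hf
      rcases main f hf hn with h | ⟨x, hxf, hqx, hxy⟩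
      · exact mem_union_left _ (mem_image_of_mem c (mem_touching.2 ⟨hf, h⟩))
      · have hx : x ∈ nbrs G q := by simpa
        rw [nbrs_eq_pair hq2 hyq.symm hqw hwy] at hx
        have hx : x = w := by simpa [hxy] using hx
        exact mem_union_right _ (mem_image_of_mem c (mem_incident.2 ⟨hf, hx ▸ hxf⟩))
    · refine ⟨∅, by simp, fun α hα => ?_⟩
      obtain ⟨f, hf, rfl⟩ := mem_image.1 hα
      obtain ⟨hf, hn⟩ := mem_filter.1 hf
      rcases main f hf hn with h | ⟨x, hxf, hqx, hxy⟩
      · exact mem_union_left _ (mem_image_of_mem c (mem_touching.2 ⟨hf, h⟩))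
      · have : 1 < deg G q := one_lt_card.2 ⟨x, by simpa, y, by simpa using hyq.symm, hxy⟩
        omega
  obtain ⟨s, hs, hsub⟩ := hsub
  have h1 := card_le_card hsub
  have h2 := card_union_le ((touching A (bigNbrs G y)).image c) (s.image c)
  have h3 := card_image_le (s := s) (f := c)
  omega

end VertexTypes

/-! ### Reducibility of starved vertices. -/

section StarvedVertices

variable {V : Type*} [Fintype V] {G : SimpleGraph V} {D : ℕ} {A : Finset (Sym2 V)}
  {u v w x y z : V}

/-- The flexible edges at a full vertex; empty at all other vertices. -/
noncomputable def fullFlexEdges (G : SimpleGraph V) (y : V) : Finset (Sym2 V) :=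
  if Full G y then flexEdges G y else ∅

lemma mem_fullFlexEdges {e : Sym2 V} : e ∈ fullFlexEdges G y ↔ Full G y ∧ e ∈ flexEdges G y := by
  unfold fullFlexEdges
  split_ifs with h <;> simp [h]

lemma notMem_freeEdges {e : Sym2 V} (hw : w ∈ e) (hdeg : 3 ≤ deg G w) (hbig : 2 ≤ #(bigNbrs G w)) :
    e ∉ freeEdges G := by
  intro he
  obtain ⟨-, x, t, rfl, ht, hx⟩ := mem_filter.1 he
  rcases Sym2.mem_iff.1 hw with rfl | rfl
  · omega
  · have := ht.1
    omega

lemma notMem_flexEdges {e : Sym2 V} (hw : w ∈ e) (hdeg : 3 ≤ deg G w) (hne : w ≠ y) :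
    e ∉ flexEdges G y := by
  intro he
  obtain ⟨-, q, rfl, hq⟩ := mem_filter.1 he
  rcases Sym2.mem_iff.1 hw with rfl | rfl
  · exact hne rfl
  · omega

lemma incident_card_le_of_forall {s : Finset V} (hA : A ⊆ edges G)
    (h : ∀ x, G.Adj y x → s(y, x) ∈ A → x ∈ s) : #(incident A y) ≤ #s :=
  (incident_card_le hA).trans (card_le_card fun x hx => by
    obtain ⟨hx, he⟩ := mem_filter.1 hx
    exact h x (mem_nbrs.1 hx) he)

/-- Both forms of stinginess give the same room. In the first, `w` accounts for 3 of the degree sum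
`2 * D + 3`. At a full vertex, once the free and flexible edges are gone, only the two big
neighbours other than `w` still meet edges. -/
lemma Stingy.card_bounds (hy : Stingy G D y) (hdeg : ∀ x, deg G x ≤ D) (hwy : G.Adj w y)
    (hw : deg G w = 3) (hA : A ⊆ edges G) (hfree : Disjoint A (freeEdges G))
    (hAw : ∀ e ∈ A, w ∉ e) (hflex : Disjoint A (fullFlexEdges G y)) :
    #(touching A ((nbrs G y).erase w)) ≤ 2 * D ∧ #(incident A y) ≤ 4 ∧
      (Full G y → #(incident A y) ≤ 2) := by
  by_cases hfull : Full G y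
  · have hflex' : Disjoint A (flexEdges G y) := by simpa [fullFlexEdges, hfull] using hflex
    have hcard : #((bigNbrs G y).erase w) = 2 := by
      rw [card_erase_of_mem (by simp [hwy.symm, hw]), hfull.1]
    have h2 : #(incident A y) ≤ 2 := by
      rw [← hcard]
      refine incident_card_le_of_forall hA fun x hx he => ?_
      refine mem_erase.2 ⟨fun h => hAw _ he (by simp [h]), mem_bigNbrs.2 ⟨hx, ?_⟩⟩
      by_contra hlt
      exact disjoint_left.1 hflex' he (mem_flexEdges hx (by omega))
    refine ⟨?_, by omega, fun _ => h2⟩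
    calc #(touching A ((nbrs G y).erase w)) ≤ ∑ x ∈ (nbrs G y).erase w, #(incident A x) :=
          touching_card_le _
      _ = ∑ x ∈ (bigNbrs G y).erase w, #(incident A x) := by
          symm
          refine sum_subset (erase_subset_erase _ (filter_subset _ _)) fun x hx hx' => ?_
          simp only [mem_erase, mem_nbrs, mem_bigNbrs, not_and] at hx hx'
          rw [hfull.incident_eq_empty hA hfree hflex' hx.2 (by have := hx' hx.1 hx.2; omega),
            card_empty]
      _ ≤ ∑ x ∈ (bigNbrs G y).erase w, D :=
          sum_le_sum fun x _ => (incident_card_le_deg hA).trans (hdeg x)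
      _ = 2 * D := by rw [sum_const, hcard, smul_eq_mul]
  · obtain ⟨hd, hS⟩ := hy.resolve_right hfull
    refine ⟨?_, ?_, fun h => absurd h hfull⟩
    · have h1 := nbrDegSum_erase hwy.symm
      have h2 := touching_card_le (A := A) ((nbrs G y).erase w)
      have h3 : ∑ x ∈ (nbrs G y).erase w, #(incident A x) ≤ ∑ x ∈ (nbrs G y).erase w, deg G x :=
        sum_le_sum fun x _ => incident_card_le_deg hA
      omega
    · have h1 : #(incident A y) ≤ #((nbrs G y).erase w) :=
        incident_card_le_of_forall hA fun x hx he =>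
          mem_erase.2 ⟨fun h => hAw _ he (by simp [h]), by simpa⟩
      rw [card_erase_of_mem (by simpa using hwy.symm)] at h1
      change _ ≤ deg G y - 1 at h1
      omega

/-- Supplies the colour bound required by `Full.exists_extend`. Unless `y` and `z` are adjacent, the
only colours around the big neighbours of `y` are the old ones and `γ`, `ζ`, `μ`, one of which was
saved. -/
lemma Full.card_image_touching_le {A' : Finset (Sym2 V)} {c c' : Sym2 V → Fin (3 * D)}
    {γ ζ μ : Fin (3 * D)} (hy : Full G y) (hdeg : ∀ x, deg G x ≤ D) (hw : deg G w = 3)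
    (hwy : G.Adj w y) (hz3 : 3 ≤ deg G z) (hwz : w ≠ z)
    (hnw : nbrs G w = {u, y, z}) (hA' : A' ⊆ edges G)
    (hcol : ∀ f ∈ A', (f ∈ A ∧ c' f = c f) ∨ (w ∈ f ∧ (c' f = γ ∨ c' f = ζ ∨ c' f = μ)) ∨
      f ∈ flexEdges G z) (hAw : ∀ e ∈ A, w ∉ e)
    (hcard : #(insert μ (insert ζ (insert γ ((touching A ((nbrs G y).erase w)).image c)))) ≤
      2 * D + 2) :
    #((touching A' (bigNbrs G y)).image c') ≤ 2 * D + 2 := by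
  have hwbig : w ∈ bigNbrs G y := by simp [hwy.symm, hw]
  by_cases hyz : G.Adj y z
  · have hzbig : z ∈ (bigNbrs G y).erase w := by simp [hyz, hz3, hwz.symm]
    -- When `z` is itself a big neighbour of `y`, the edge `s(w, z)` is already counted at `z`. This
    -- gives `2 + D + D` edges without any repeated colour.
    have hsub : touching A' (bigNbrs G y) ⊆ {s(w, u), s(w, y)} ∪
        (incident A' z ∪ touching A' (((bigNbrs G y).erase w).erase z)) := by
      intro f hf
      obtain ⟨hf, x, hx, hxf⟩ := mem_touching.1 hf
      simp only [mem_union, mem_touching, mem_incident, mem_insert, mem_singleton, mem_erase]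
      by_cases hzf : z ∈ f
      · exact Or.inr (Or.inl ⟨hf, hzf⟩)
      by_cases hwf : w ∈ f
      · obtain ⟨t, ht, rfl⟩ := exists_eq_of_mem_edges (hA' hf) hwf
        have ht : t ∈ nbrs G w := by simpa
        rw [hnw] at ht
        simp only [mem_insert, mem_singleton] at ht
        rcases ht with rfl | rfl | rfl
        · simp
        · simp
        · simp at hzf
      · exact Or.inr (Or.inr ⟨hf, x, ⟨fun h => hzf (h ▸ hxf), fun h => hwf (h ▸ hxf), hx⟩, hxf⟩)
    have h1 := card_le_card hsub
    have h2 := card_union_le {s(w, u), s(w, y)}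
      (incident A' z ∪ touching A' (((bigNbrs G y).erase w).erase z))
    have h3 := card_union_le (incident A' z) (touching A' (((bigNbrs G y).erase w).erase z))
    have h4 : #({s(w, u), s(w, y)} : Finset (Sym2 V)) ≤ 2 := card_le_two
    have h5 : #(incident A' z) ≤ D := (incident_card_le_deg hA').trans (hdeg z)
    have h6 : #(touching A' (((bigNbrs G y).erase w).erase z)) ≤ D := by
      refine (touching_card_le _).trans ((sum_le_card_nsmul _ _ D fun x _ =>
        (incident_card_le_deg hA').trans (hdeg x)).trans ?_)
      rw [card_erase_of_mem hzbig, card_erase_of_mem hwbig, hy.1]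
      simp
    have h7 := card_image_le (s := touching A' (bigNbrs G y)) (f := c')
    omega
  · refine (card_le_card fun α hα => ?_).trans hcard
    obtain ⟨f, hf, rfl⟩ := mem_image.1 hα
    obtain ⟨hf, x, hx, hxf⟩ := mem_touching.1 hf
    rw [mem_bigNbrs] at hx
    rcases hcol f hf with ⟨hfA, heq⟩ | ⟨-, h⟩ | h
    · rw [heq]
      refine mem_insert_of_mem (mem_insert_of_mem (mem_insert_of_mem (mem_image_of_mem c ?_)))
      exact mem_touching.2 ⟨hfA, x, by simpa [hx.1] using fun h : x = w => hAw f hfA (h ▸ hxf), hxf⟩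
    · simp only [mem_insert]
      tauto
    · exact absurd h (notMem_flexEdges hxf hx.2 fun h => hyz (h ▸ hx.1))

lemma Light.exists_nbrs (hw : Light G w) : ∃ u y z, y ≠ z ∧ u ≠ y ∧ u ≠ z ∧ nbrs G w = {u, y, z} ∧
    deg G u = 2 ∧ bigNbrs G w = {y, z} := by
  obtain ⟨h3, hbig, htwo⟩ := hw
  obtain ⟨y, z, hyz, hbig'⟩ := card_eq_two.1 hbig
  obtain ⟨u, htwo'⟩ := card_eq_one.1 htwo
  have hleaf : leafNbrs G w = ∅ := by
    have := deg_eq_add (G := G) (v := w)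
    rw [← card_eq_zero]
    omega
  have hu : u ∈ twoNbrs G w := by simp [htwo']
  have hy : y ∈ bigNbrs G w := by simp [hbig']
  have hz : z ∈ bigNbrs G w := by simp [hbig']
  rw [mem_twoNbrs] at hu
  rw [mem_bigNbrs] at hy hz
  refine ⟨u, y, z, hyz, ?_, ?_, ?_, hu.2, hbig'⟩
  · rintro rfl
    omega
  · rintro rfl
    omega
  · ext x
    simp only [mem_insert, mem_singleton]
    constructor
    · intro hx
      rw [mem_nbrs] at hx
      have h1 : x ∉ leafNbrs G w := by simp [hleaf]
      have h2 : x ∈ twoNbrs G w ↔ x = u := by simp [htwo']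
      have h3 : x ∈ bigNbrs G w ↔ x = y ∨ x = z := by simp [hbig']
      rw [← h2, ← h3, mem_twoNbrs, mem_bigNbrs]
      simp only [mem_leafNbrs, hx, true_and] at h1 ⊢
      have := deg_pos_of_adj hx.symm
      omega
    · rintro (rfl | rfl | rfl)
      · simp [hu.1]
      · simp [hy.1]
      · simp [hz.1]

/-- The edges at a starved vertex can be added to any set of edges that can be coloured. -/
lemma Starved.colorableOn_union (hD : 7 ≤ D) (hdeg : ∀ x, deg G x ≤ D) (hw : Starved G D w)
    (h : ColorableOn G (3 * D) A) : ColorableOn G (3 * D) (incident (edges G) w ∪ A) := by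
  obtain ⟨u, y, z, hyz, huy, huz, hnw, hu2, hbig⟩ := hw.1.exists_nbrs
  have hw3 := hw.1.1
  have hbig2 := hw.1.2.1
  have hwu : G.Adj w u := by rw [← mem_nbrs, hnw]; simp
  have hwy : G.Adj w y := by rw [← mem_nbrs, hnw]; simp
  have hwz : G.Adj w z := by rw [← mem_nbrs, hnw]; simp
  have hy : y ∈ bigNbrs G w := by simp [hbig]
  have hz : z ∈ bigNbrs G w := by simp [hbig]
  have hys := hw.2 y hy
  have hzs := hw.2 z hz
  have hy3 := (mem_bigNbrs.1 hy).2
  have hz3 := (mem_bigNbrs.1 hz).2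
  have hcases : ∀ x, G.Adj w x → x = u ∨ x = y ∨ x = z := fun x hx => by
    have : x ∈ nbrs G w := by simpa
    simpa [hnw] using this
  obtain ⟨c, hc⟩ := h
  -- Everything that can be recoloured afterwards is erased; the colours on `B` are kept.
  obtain ⟨B, hB⟩ : ∃ B, B = A \ (freeEdges G ∪ incident (edges G) w ∪ fullFlexEdges G y ∪
    fullFlexEdges G z) := ⟨_, rfl⟩
  have hcB : ColorsOn G c B := hc.mono (hB ▸ sdiff_subset)
  have hBE := hcB.1
  have hBfree : Disjoint B (freeEdges G) := disjoint_left.2 fun e he he' => by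
    simp [hB, he'] at he
  have hBw : ∀ e ∈ B, w ∉ e := fun e he hwe => by
    have := hBE he
    simp [hB, this, hwe] at he
  have hBy : Disjoint B (fullFlexEdges G y) := disjoint_left.2 fun e he he' => by
    simp [hB, he'] at he
  have hBz : Disjoint B (fullFlexEdges G z) := disjoint_left.2 fun e he he' => by
    simp [hB, he'] at he
  obtain ⟨hX, hM, hMF⟩ := hys.card_bounds hdeg hwy hw3 hBE hBfree hBw hBy
  obtain ⟨hX', hM', hMF'⟩ := hzs.card_bounds hdeg hwz hw3 hBE hBfree hBw hBz
  have hnu : #((nbrs G u).erase w) = 1 := by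
    rw [card_erase_of_mem (by simpa using hwu.symm)]
    change deg G u - 1 = 1
    omega
  have hN : #(incident B u) ≤ 1 := by
    rw [← hnu]
    exact incident_card_le_of_forall hBE fun x hx he =>
      mem_erase.2 ⟨fun h => hBw _ he (by simp [h]), by simpa⟩
  have hW : #(touching B ((nbrs G u).erase w)) ≤ D := by
    refine (touching_card_le _).trans ((sum_le_card_nsmul _ _ D fun x _ =>
      (incident_card_le_deg hBE).trans (hdeg x)).trans ?_)
    simp [hnu]
  -- Here `X` and `X'` are the colours at the neighbours of `y` and `z` other than `w`, `M` and `M'`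
  -- those at `y` and `z`, `N` those at `u`, and `W` those at the other neighbour of `u`. The edges
  -- to `y`, `z`, `u` receive `γ`, `ζ`, `μ`.
  obtain ⟨γ, ζ, μ, hγ, hζ, hμ, hcy, hcz⟩ := exists_three_colors (Full G y) (Full G z) hD
    (card_image_le (f := c).trans hX) (card_image_le (f := c).trans hX') (card_image_le (f := c).trans hN)
    (card_image_le (f := c).trans hW) (card_image_le (f := c).trans hM)
    (card_image_le (f := c).trans hM') (fun h => card_image_le.trans (hMF h))
    (fun h => card_image_le.trans (hMF' h))
  -- colour `wy`
  have hyB : s(w, y) ∉ B := fun h => hBw _ h (by simp)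
  have h1 := hcB.update (mem_edges.2 hwy) hyB (α := γ) fun hα => hγ (by
    obtain ⟨f, hf, rfl⟩ := mem_image.1 hα
    obtain ⟨hf, hn⟩ := mem_filter.1 hf
    obtain ⟨x, hxf, ⟨hx, hxy⟩ | ⟨hx, hxw⟩⟩ := exists_mem_of_near hwy (hBE hf)
      (fun h => hyB (h ▸ hf)) hn
    · rcases hcases x hx with rfl | rfl | rfl
      · exact mem_union_right _ (mem_image_of_mem c (mem_incident.2 ⟨‹_›, hxf⟩))
      · exact absurd rfl hxy
      · exact mem_union_left _ (mem_union_right _ (mem_image_of_mem c (mem_incident.2 ⟨‹_›, hxf⟩)))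
    · exact mem_union_left _ (mem_union_left _ (mem_image_of_mem c
        (mem_touching.2 ⟨hf, x, by simp [hx, hxw], hxf⟩))))
  -- colour `wz`
  have hzB : s(w, z) ∉ insert s(w, y) B := fun h => by
    rcases mem_insert.1 h with h | h
    · exact hyz (Sym2.congr_right.1 h).symm
    · exact hBw _ h (by simp)
  have hne : ∀ f ∈ B, ∀ x, f ≠ s(w, x) := fun f hf x h => hBw f hf (by simp [h])
  have h2 := h1.update (mem_edges.2 hwz) hzB (α := ζ) fun hα => hζ (by
    obtain ⟨f, hf, rfl⟩ := mem_image.1 hα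
    obtain ⟨hf, hn⟩ := mem_filter.1 hf
    rcases mem_insert.1 hf with rfl | hf
    · simp
    rw [Function.update_of_ne (hne f hf y)]
    refine mem_insert_of_mem ?_
    obtain ⟨x, hxf, ⟨hx, hxz⟩ | ⟨hx, hxw⟩⟩ := exists_mem_of_near hwz (hBE hf) (hne f hf z) hn
    · rcases hcases x hx with rfl | rfl | rfl
      · exact mem_union_right _ (mem_image_of_mem c (mem_incident.2 ⟨‹_›, hxf⟩))
      · exact mem_union_left _ (mem_union_right _ (mem_image_of_mem c (mem_incident.2 ⟨‹_›, hxf⟩)))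
      · exact absurd rfl hxz
    · exact mem_union_left _ (mem_union_left _ (mem_image_of_mem c
        (mem_touching.2 ⟨hf, x, by simp [hx, hxw], hxf⟩))))
  -- colour `wu`
  have huB : s(w, u) ∉ insert s(w, z) (insert s(w, y) B) := fun h => by
    rcases mem_insert.1 h with h | h
    · exact huz (Sym2.congr_right.1 h)
    rcases mem_insert.1 h with h | h
    · exact huy (Sym2.congr_right.1 h)
    · exact hBw _ h (by simp)
  have hzy : s(w, z) ≠ s(w, y) := fun h => hyz (Sym2.congr_right.1 h).symm
  have huy' : s(w, u) ≠ s(w, y) := fun h => huy (Sym2.congr_right.1 h)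
  have huz' : s(w, u) ≠ s(w, z) := fun h => huz (Sym2.congr_right.1 h)
  have h3 := h2.update (mem_edges.2 hwu) huB (α := μ) fun hα => hμ (by
    obtain ⟨f, hf, rfl⟩ := mem_image.1 hα
    obtain ⟨hf, hn⟩ := mem_filter.1 hf
    rcases mem_insert.1 hf with rfl | hf
    · simp
    rcases mem_insert.1 hf with rfl | hf
    · simp [Function.update_of_ne hzy.symm]
    rw [Function.update_of_ne (hne f hf z), Function.update_of_ne (hne f hf y)]
    refine mem_insert_of_mem (mem_insert_of_mem ?_)
    obtain ⟨x, hxf, ⟨hx, hxz⟩ | ⟨hx, hxw⟩⟩ := exists_mem_of_near hwu (hBE hf) (hne f hf u) hn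
    · rcases hcases x hx with rfl | rfl | rfl
      · exact absurd rfl hxz
      · exact mem_union_left _ (mem_union_right _ (mem_image_of_mem c (mem_incident.2 ⟨‹_›, hxf⟩)))
      · exact mem_union_right _ (mem_image_of_mem c (mem_incident.2 ⟨‹_›, hxf⟩))
    · exact mem_union_left _ (mem_union_left _ (mem_image_of_mem c
        (mem_touching.2 ⟨hf, x, by simp [hx, hxw], hxf⟩))))
  obtain ⟨c₃, hc₃⟩ : ∃ c₃, c₃ = Function.update (Function.update (Function.update c s(w, y) γ)
    s(w, z) ζ) s(w, u) μ := ⟨_, rfl⟩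
  obtain ⟨B₃, hB₃⟩ : ∃ B₃, B₃ = insert s(w, u) (insert s(w, z) (insert s(w, y) B)) := ⟨_, rfl⟩
  rw [← hc₃, ← hB₃] at h3
  have hcol : ∀ f ∈ B₃, (f ∈ B ∧ c₃ f = c f) ∨ (w ∈ f ∧ (c₃ f = γ ∨ c₃ f = ζ ∨ c₃ f = μ)) := by
    intro f hf
    simp only [hB₃, mem_insert] at hf
    rcases hf with rfl | rfl | rfl | hf
    · exact Or.inr ⟨by simp, by simp [hc₃]⟩
    · exact Or.inr ⟨by simp, by simp [hc₃, Function.update_of_ne huz'.symm]⟩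
    · exact Or.inr ⟨by simp, by
        simp [hc₃, Function.update_of_ne huy'.symm, Function.update_of_ne hzy.symm]⟩
    · exact Or.inl ⟨hf, by simp [hc₃, Function.update_of_ne (hne f hf _)]⟩
  have hfree₃ : Disjoint B₃ (freeEdges G) := disjoint_left.2 fun f hf hf' => by
    rcases hcol f hf with h | h
    · exact disjoint_left.1 hBfree h.1 hf'
    · exact notMem_freeEdges h.1 hw3.ge hbig2.ge hf'
  have hflex₃ : ∀ {t}, w ≠ t → Full G t → Disjoint B (fullFlexEdges G t) →
      Disjoint B₃ (flexEdges G t) := fun {t} ht htf hBt => disjoint_left.2 fun f hf hf' => by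
    rcases hcol f hf with h | h
    · exact disjoint_left.1 hBt h.1 (mem_fullFlexEdges.2 ⟨htf, hf'⟩)
    · exact notMem_flexEdges h.1 hw3.ge ht hf'
  obtain ⟨c₄, hc₄, hcc₄⟩ : ∃ c₄ : Sym2 V → Fin (3 * D), ColorsOn G c₄ (fullFlexEdges G z ∪ B₃) ∧
      ∀ e ∈ B₃, c₄ e = c₃ e := by
    by_cases hzf : Full G z
    · rw [fullFlexEdges, if_pos hzf]
      refine hzf.exists_extend hdeg h3 hfree₃ (hflex₃ hwz.ne hzf hBz) ?_
      refine hzf.card_image_touching_le hdeg hw3 hwz hy3 hwy.ne (u := u) ?_ h3.1 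
        (fun f hf => (hcol f hf).imp_right Or.inl) hBw (hcz hzf)
      rw [hnw, pair_comm y z]
    · exact ⟨c₃, by simpa [fullFlexEdges, hzf] using h3, fun _ _ => rfl⟩
  -- The edges just coloured at `z` can matter around the big neighbours of `y` only if `z` is one
  -- of them, and then all edges at `z` were counted anyway.
  obtain ⟨c₅, hc₅⟩ : ∃ c₅ : Sym2 V → Fin (3 * D),
      ColorsOn G c₅ (fullFlexEdges G y ∪ (fullFlexEdges G z ∪ B₃)) := by
    by_cases hyf : Full G y
    · rw [fullFlexEdges, if_pos hyf]
      have hzmem : ∀ f ∈ fullFlexEdges G z, z ∈ f := fun f hf => by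
        obtain ⟨-, q, rfl, -⟩ := mem_filter.1 (mem_fullFlexEdges.1 hf).2
        simp
      obtain ⟨c₅, hc₅, -⟩ := hyf.exists_extend hdeg hc₄
        (disjoint_union_left.2 ⟨disjoint_left.2 fun f hf => notMem_freeEdges (hzmem f hf) hz3
          (by have := (mem_fullFlexEdges.1 hf).1.1; omega), hfree₃⟩)
        (disjoint_union_left.2 ⟨disjoint_left.2 fun f hf => notMem_flexEdges (hzmem f hf) hz3
          hyz.symm, hflex₃ hwy.ne hyf hBy⟩)
        (hyf.card_image_touching_le hdeg hw3 hwy hz3 hwz.ne hnw hc₄.1 (fun f hf => by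
          rcases mem_union.1 hf with hf | hf
          · exact Or.inr (Or.inr (mem_fullFlexEdges.1 hf).2)
          · rw [hcc₄ f hf]
            exact (hcol f hf).imp_right Or.inl) hBw (hcy hyf))
      exact ⟨c₅, hc₅⟩
    · exact ⟨c₄, by simpa [fullFlexEdges, hyf] using hc₄⟩
  refine (ColorableOn.union_freeEdges hD hdeg ⟨c₅, hc₅⟩).mono fun e he => ?_
  by_cases hwe : e ∈ incident (edges G) w
  · obtain ⟨hwe, hwe'⟩ := mem_incident.1 hwe
    obtain ⟨x, hx, rfl⟩ := exists_eq_of_mem_edges hwe hwe'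
    rcases hcases x hx with rfl | rfl | rfl <;> simp [hB₃]
  · have heA : e ∈ A := (mem_union.1 he).resolve_left hwe
    by_cases heB : e ∈ B
    · simp [hB₃, heB]
    · simp only [hB, mem_sdiff, heA, mem_union, true_and, not_not] at heB
      rcases heB with ((h | h) | h) | h
      · exact mem_union_left _ h
      · exact absurd h hwe
      · exact mem_union_right _ (mem_union_left _ h)
      · exact mem_union_right _ (mem_union_right _ (mem_union_left _ h))

end StarvedVertices

/-! ### Degree-sum bounds in critical graphs. -/

section CriticalGraphs

variable {V : Type*} [Fintype V] {G : SimpleGraph V} {D : ℕ} {A : Finset (Sym2 V)}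
  {u v w x y z : V}

/-- A graph of maximum degree at most `D` without a strong colouring with `3 * D` colours, such
that the edges avoiding a non-isolated vertex can always be coloured. -/
structure Critical (G : SimpleGraph V) (D : ℕ) : Prop where
  seven_le : 7 ≤ D
  deg_le : ∀ x, deg G x ≤ D
  not_colorable : ¬ ColorableOn G (3 * D) (edges G)
  colorable_avoiding : ∀ u x, G.Adj u x → ColorableOn G (3 * D) ((edges G).filter (u ∉ ·))

/-- The edges that are neither free nor incident to a starved vertex. -/
noncomputable def coreEdges (G : SimpleGraph V) (D : ℕ) : Finset (Sym2 V) :=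
  (edges G).filter fun e => e ∉ freeEdges G ∧ ∀ w ∈ e, ¬ Starved G D w

/-- Starved vertices are restored one at a time, which works because `Starved.colorableOn_union`
accepts an arbitrary colourable set; the free edges follow. -/
lemma ColorableOn.of_coreEdges (hD : 7 ≤ D) (hdeg : ∀ x, deg G x ≤ D)
    (h : ColorableOn G (3 * D) A) (hA : coreEdges G D ⊆ A) : ColorableOn G (3 * D) (edges G) := by
  have key : ∀ s : Finset V, (∀ w ∈ s, Starved G D w) →
      ColorableOn G (3 * D) (s.biUnion (incident (edges G)) ∪ A) := by
    intro s
    induction s using Finset.induction_on with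
    | empty => simpa using h
    | insert w s _ ih =>
      intro hs
      rw [biUnion_insert, union_assoc]
      exact (hs w (mem_insert_self w s)).colorableOn_union hD hdeg
        (ih fun t ht => hs t (mem_insert_of_mem ht))
  refine ((key (univ.filter (Starved G D)) (by simp)).union_freeEdges hD hdeg).mono fun e he => ?_
  by_cases hf : e ∈ freeEdges G
  · exact mem_union_left _ hf
  by_cases hs : ∃ w ∈ e, Starved G D w
  · obtain ⟨w, hwe, hw⟩ := hs
    exact mem_union_right _ (mem_union_left _ (mem_biUnion.2 ⟨w, by simpa, by simp [he, hwe]⟩))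
  · push Not at hs
    exact mem_union_right _ (mem_union_right _ (hA (mem_filter.2 ⟨he, hf, hs⟩)))

lemma Critical.lt_nbrDegSum_of_leaf (h : Critical G D) (hu : deg G u = 1) (hvu : G.Adj v u) :
    3 * D + 1 ≤ nbrDegSum G v := by
  by_contra hlt
  have hu' : (nbrs G u).erase v = ∅ := by
    rw [← card_eq_zero, card_erase_of_mem (by simpa using hvu.symm)]
    change deg G u - 1 = 0
    omega
  have hAE : (edges G).filter (u ∉ ·) ⊆ edges G := filter_subset _ _
  refine h.not_colorable (((h.colorable_avoiding u v hvu.symm).insert hvu (by simp) ?_).mono ?_)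
  · rw [hu', sum_empty, add_zero]
    have h1 := nbrDegSum_erase hvu
    refine (sum_le_sum fun x _ => incident_card_le_deg hAE).trans_lt ?_
    omega
  · intro e he
    by_cases hue : u ∈ e
    · obtain ⟨x, hx, rfl⟩ := exists_eq_of_mem_edges he hue
      have : x = v := by
        by_contra hne
        have : x ∈ (nbrs G u).erase v := by simp [hx, hne]
        simp [hu'] at this
      subst this
      simp [Sym2.eq_swap]
    · simp [he, hue]

lemma disjoint_thinNbrs_starvedNbrs : Disjoint (thinNbrs G v) (starvedNbrs G D v) := by
  rw [disjoint_left]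
  intro u hu hu'
  obtain ⟨⟨hvu, hu2⟩, w, huw, hwv, hw⟩ := mem_thinNbrs.1 hu
  obtain ⟨-, w', huw', hwv', hw'⟩ := mem_starvedNbrs.1 hu'
  have h1 : w' ∈ nbrs G u := by simpa
  rw [nbrs_eq_pair hu2 hvu.symm huw hwv] at h1
  have h2 : w' = w := by simpa [hwv'] using h1
  subst h2
  have := hw.1
  have := hw'.1.2.1
  omega

/-- Otherwise the core edges avoiding `u` could be coloured and then `s(v, u)`, the only core edge
that may remain at `u`, giving a colouring of all core edges. -/
lemma Critical.le_nbrDegSum_of_bad (h : Critical G D) (hvu : G.Adj v u) (hu2 : deg G u = 2)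
    (huw : G.Adj u w) (hwv : w ≠ v) (hw : Thin G w ∨ Starved G D w) :
    3 * D + #(thinNbrs G v) + #(starvedNbrs G D v) + 1 ≤
      nbrDegSum G v + #(incident (coreEdges G D) w) := by
  set A := (coreEdges G D).filter (u ∉ ·) with hA
  have hAE : A ⊆ edges G := (filter_subset _ _).trans (filter_subset _ _)
  have hcol : ColorableOn G (3 * D) A := by
    refine (h.colorable_avoiding u v hvu.symm).mono fun e he => ?_
    obtain ⟨he, hue⟩ := mem_filter.1 he
    exact mem_filter.2 ⟨(mem_filter.1 he).1, hue⟩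
  have huA : s(v, u) ∉ A := by simp [hA]
  have hother : ∀ {x t}, G.Adj x t → deg G x = 2 → Thin G t ∨ Starved G D t →
      s(x, t) ∉ coreEdges G D := fun {x t} hxt hx ht hmem => by
    obtain ⟨-, hf, hs⟩ := mem_filter.1 hmem
    rcases ht with ht | ht
    · exact hf (mem_freeEdges hxt ht hx.le)
    · exact hs t (by simp) ht
  set bad := thinNbrs G v ∪ starvedNbrs G D v with hbad
  have hbadcard : #bad = #(thinNbrs G v) + #(starvedNbrs G D v) :=
    card_union_of_disjoint disjoint_thinNbrs_starvedNbrs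
  have hmem : ∀ x, x ∈ bad ↔ (G.Adj v x ∧ deg G x = 2) ∧
      ∃ t, G.Adj x t ∧ t ≠ v ∧ (Thin G t ∨ Starved G D t) := by
    intro x
    rw [hbad, mem_union, mem_thinNbrs, mem_starvedNbrs]
    constructor
    · rintro (⟨h, t, h1, h2, h3⟩ | ⟨h, t, h1, h2, h3⟩)
      · exact ⟨h, t, h1, h2, Or.inl h3⟩
      · exact ⟨h, t, h1, h2, Or.inr h3⟩
    · rintro ⟨h, t, h1, h2, h3 | h3⟩
      · exact Or.inl ⟨h, t, h1, h2, h3⟩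
      · exact Or.inr ⟨h, t, h1, h2, h3⟩
  have hubad : u ∈ bad := (hmem u).2 ⟨⟨hvu, hu2⟩, w, huw, hwv, hw⟩
  -- Each further bad neighbour of `v` saves one conflict, since its edge away from `v` is not a
  -- core edge.
  have hsum : ∑ x ∈ (nbrs G v).erase u, #(incident A x) + #(bad.erase u) ≤
      ∑ x ∈ (nbrs G v).erase u, deg G x := by
    have : #(bad.erase u) = ∑ x ∈ (nbrs G v).erase u, if x ∈ bad then 1 else 0 := by
      rw [← card_filter]
      congr 1
      ext x
      simp only [mem_erase, mem_filter, mem_nbrs]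
      constructor
      · rintro ⟨h1, h2⟩
        exact ⟨⟨h1, ((hmem x).1 h2).1.1⟩, h2⟩
      · rintro ⟨⟨h1, -⟩, h2⟩
        exact ⟨h1, h2⟩
    rw [this, ← sum_add_distrib]
    refine sum_le_sum fun x _ => ?_
    split_ifs with hx
    · obtain ⟨⟨hvx, hx2⟩, t, hxt, htv, ht⟩ := (hmem x).1 hx
      have : #(incident A x) ≤ #({v} : Finset V) :=
        incident_card_le_of_forall hAE fun s hs hmem => by
          have h1 : s ∈ nbrs G x := by simpa
          rw [nbrs_eq_pair hx2 hvx.symm hxt htv] at h1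
          rcases mem_insert.1 h1 with rfl | h1
          · simp
          · rw [mem_singleton] at h1
            subst h1
            exact absurd (mem_filter.1 hmem).1 (hother hxt hx2 ht)
      rw [card_singleton] at this
      omega
    · exact incident_card_le_deg hAE
  have hnu : (nbrs G u).erase v = {w} := by
    rw [nbrs_eq_pair hu2 hvu.symm huw hwv]
    exact erase_insert (by simpa using hwv.symm)
  have hcore : coreEdges G D ⊆ insert s(v, u) A := by
    intro e he
    by_cases hue : u ∈ e
    · obtain ⟨x, hx, rfl⟩ := exists_eq_of_mem_edges (mem_filter.1 he).1 hue
      have h1 : x ∈ nbrs G u := by simpa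
      rw [nbrs_eq_pair hu2 hvu.symm huw hwv] at h1
      rcases mem_insert.1 h1 with rfl | h1
      · simp [Sym2.eq_swap]
      · rw [mem_singleton] at h1
        subst h1
        exact absurd he (hother huw hu2 hw)
    · simp [hA, he, hue]
  by_contra hlt
  refine h.not_colorable ((hcol.insert hvu huA ?_).of_coreEdges h.seven_le h.deg_le hcore)
  rw [hnu, sum_singleton]
  have h1 := nbrDegSum_erase hvu
  have h2 : #(incident A w) ≤ #(incident (coreEdges G D) w) :=
    card_le_card (filter_subset_filter _ (filter_subset _ _))
  have h3 := card_erase_of_mem hubad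
  have h4 : 0 < #bad := card_pos.2 ⟨u, hubad⟩
  omega

lemma Critical.le_nbrDegSum_of_thinNbrs (h : Critical G D) (hv : 1 ≤ #(thinNbrs G v)) :
    3 * D + #(thinNbrs G v) + #(starvedNbrs G D v) ≤ nbrDegSum G v := by
  obtain ⟨u, hu⟩ := card_pos.1 hv
  obtain ⟨⟨hvu, hu2⟩, w, huw, hwv, hw⟩ := mem_thinNbrs.1 hu
  have h1 := h.le_nbrDegSum_of_bad hvu hu2 huw hwv (Or.inl hw)
  have h2 := hw.incident_card_le (A := coreEdges G D) (filter_subset _ _)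
    (disjoint_left.2 fun e he => (mem_filter.1 he).2.1)
  omega

lemma Critical.lt_nbrDegSum_of_starvedNbrs (h : Critical G D) (hv : 1 ≤ #(starvedNbrs G D v)) :
    3 * D + #(thinNbrs G v) + #(starvedNbrs G D v) + 1 ≤ nbrDegSum G v := by
  obtain ⟨u, hu⟩ := card_pos.1 hv
  obtain ⟨⟨hvu, hu2⟩, w, huw, hwv, hw⟩ := mem_starvedNbrs.1 hu
  have h1 := h.le_nbrDegSum_of_bad hvu hu2 huw hwv (Or.inr hw)
  have h2 : incident (coreEdges G D) w = ∅ := eq_empty_iff_forall_notMem.2 fun e he => by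
    obtain ⟨he, hwe⟩ := mem_incident.1 he
    exact (mem_filter.1 he).2.2 w hwe hw
  rw [h2, card_empty] at h1
  omega

lemma nbrDegSum_le (hdeg : ∀ x, deg G x ≤ D) : nbrDegSum G v ≤
    #(leafNbrs G v) + 2 * #(twoNbrs G v) + 3 * #(lightNbrs G v) +
      D * (#(bigNbrs G v) - #(lightNbrs G v)) := by
  have hsub : lightNbrs G v ⊆ bigNbrs G v := fun x hx => by
    obtain ⟨h1, h2⟩ := mem_lightNbrs.1 hx
    exact mem_bigNbrs.2 ⟨h1, h2.1.ge⟩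
  rw [← card_sdiff_of_subset hsub]
  calc nbrDegSum G v ≤ ∑ x ∈ nbrs G v, ((if deg G x = 1 then 1 else 0) +
        (if deg G x = 2 then 2 else 0) + (if Light G x then 3 else 0) +
        if x ∈ bigNbrs G v \ lightNbrs G v then D else 0) := by
        refine sum_le_sum fun x hx => ?_
        rw [mem_nbrs] at hx
        have h1 := deg_pos_of_adj hx.symm
        have h2 := hdeg x
        simp only [mem_sdiff, mem_bigNbrs, mem_lightNbrs, hx, true_and]
        by_cases hl : Light G x
        · have := hl.1
          simp [hl, this]
        · simp only [hl]
          split_ifs <;> simp_all; omega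
    _ = _ := by
        have h1 : (nbrs G v).filter (· ∈ bigNbrs G v \ lightNbrs G v) =
            bigNbrs G v \ lightNbrs G v := by
          ext x
          simp
          tauto
        simp only [sum_add_distrib, ← sum_filter, sum_const, smul_eq_mul, h1]
        simp only [leafNbrs, twoNbrs, lightNbrs]
        ring

lemma lightNbrs_card_le : #(lightNbrs G v) ≤ #(bigNbrs G v) := card_le_card fun x hx => by
  obtain ⟨h1, h2⟩ := mem_lightNbrs.1 hx
  exact mem_bigNbrs.2 ⟨h1, h2.1.ge⟩

end CriticalGraphs

/-! ### Charge inequalities: `p`, `t`, `r`, `a`, `b`, `b'` count leaf, degree-two, big, light, thin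
and starved neighbours, and `S` is the degree sum. -/

section Arithmetic

variable {D p t r a b b' S : ℕ}

lemma charge_of_thin (hD : 7 ≤ D) (hd3 : 3 ≤ p + t + r) (hS : S ≤ p + 2 * t + 3 * a + D * (r - a))
    (har : a ≤ r) (hd : p + t + r ≤ 5) (hp : 1 ≤ p → 3 * D + 1 ≤ S)
    (hr : r ≤ 1) : 3 ≤ r + t ∧ S ≤ 2 * D + 3 := by
  interval_cases r <;> interval_cases a <;> simp only [Nat.sub_self, Nat.sub_zero] at hS <;> omega

/-- With three big neighbours the payments are covered, as `b + b' ≤ t`. With fewer, a leaf or a bad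
neighbour needs a degree sum near `3 * D`, which forces many neighbours of degree two or is
impossible. -/
lemma charge_of_stingy (hD : 7 ≤ D) (hd3 : 3 ≤ p + t + r)
    (hS : S ≤ p + 2 * t + 3 * a + D * (r - a)) (har : a ≤ r) (hd : p + t + r ≤ D)
    (hp : 1 ≤ p → 3 * D + 1 ≤ S) (hb : 1 ≤ b → 3 * D + b + b' ≤ S)
    (hb' : 1 ≤ b' → 3 * D + b + b' + 1 ≤ S) (hbt : b + b' ≤ t)
    (hthin : ¬ (r ≤ 1 ∧ p + t + r ≤ 5)) (hlight : ¬ (p + t + r = 3 ∧ r = 2 ∧ t = 1)) :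
    6 + t + b + b' ≤ 2 * (r + t) := by
  rcases Nat.lt_or_ge r 3 with hr | hr
  · interval_cases r <;> interval_cases a <;> norm_num at hS <;> omega
  · omega

/-- Light neighbours cost `a` more but contribute only 3 each to `S`. The case `r = 3`, `a = 1`, `b
= t` would miss by one; it is excluded by `hfull`, which is the reason for the notion `Full`. -/
lemma charge_of_not_stingy (hD : 7 ≤ D) (hd3 : 3 ≤ p + t + r)
    (hS : S ≤ p + 2 * t + 3 * a + D * (r - a)) (har : a ≤ r) (hd : p + t + r ≤ D)
    (hp : 1 ≤ p → 3 * D + 1 ≤ S) (hb : 1 ≤ b → 3 * D + b + b' ≤ S)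
    (hb' : 1 ≤ b' → 3 * D + b + b' + 1 ≤ S) (hbt : b + b' ≤ t)
    (hthin : ¬ (r ≤ 1 ∧ p + t + r ≤ 5)) (hlight : ¬ (p + t + r = 3 ∧ r = 2 ∧ t = 1))
    (hsmall : ¬ (p + t + r ≤ 5 ∧ S ≤ 2 * D + 3)) (hfull : r = 3 → a = 1 → b < t) :
    6 + t + b + b' + a ≤ 2 * (r + t) := by
  rcases Nat.lt_or_ge r 6 with hr | hr
  · interval_cases r <;> interval_cases a <;> norm_num at hS <;> omega
  · omega

lemma not_thin_not_light_of_bad (hD : 7 ≤ D)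
    (hS : S ≤ p + 2 * t + 3 * a + D * (r - a)) (har : a ≤ r) (hd : p + t + r ≤ D)
    (hb : 1 ≤ b → 3 * D + b + b' ≤ S)
    (hb' : 1 ≤ b' → 3 * D + b + b' + 1 ≤ S) (hbb : 1 ≤ b + b') :
    ¬ (r ≤ 1 ∧ p + t + r ≤ 5) ∧ ¬ (p + t + r = 3 ∧ r = 2 ∧ t = 1) := by
  rcases Nat.lt_or_ge r 3 with hr | hr
  · interval_cases r <;> interval_cases a <;> norm_num at hS <;> omega
  · omega

end Arithmetic

/-! ### Discharging. -/

section Discharging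

variable {V : Type*} [Fintype V] {G : SimpleGraph V} {D : ℕ} {u v w x y z : V}

/-- Every nonempty set `S` of vertices spans fewer than `3|S|/2` edges. -/
def Sparse (G : SimpleGraph V) : Prop :=
  ∀ S : Finset V, S.Nonempty → 2 * #((edges G).filter fun e => ∀ x ∈ e, x ∈ S) < 3 * #S

/-- The charge that `v` sends to `u`. -/
noncomputable def gift (G : SimpleGraph V) (D : ℕ) (v u : V) : ℕ :=
  (if (u ∈ twoNbrs G v ∧ ¬ Thin G v) ∧ ¬ Starved G D v then 1 else 0) +
  (if (u ∈ thinNbrs G v ∧ ¬ Thin G v) ∧ ¬ Starved G D v then 1 else 0) +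
  (if (u ∈ starvedNbrs G D v ∧ ¬ Thin G v) ∧ ¬ Starved G D v then 1 else 0) +
  (if u ∈ lightNbrs G v ∧ ¬ Stingy G D v then 1 else 0)

lemma thinNbrs_subset : thinNbrs G v ⊆ twoNbrs G v := filter_subset _ _

lemma starvedNbrs_subset : starvedNbrs G D v ⊆ twoNbrs G v := filter_subset _ _

lemma card_thinNbrs_add_card_starvedNbrs_le :
    #(thinNbrs G v) + #(starvedNbrs G D v) ≤ #(twoNbrs G v) := by
  rw [← card_union_of_disjoint disjoint_thinNbrs_starvedNbrs]
  exact card_le_card (union_subset thinNbrs_subset starvedNbrs_subset)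

lemma sum_gift_le (S : Finset V) : ∑ u ∈ S, gift G D v u ≤
    (if ¬ Thin G v ∧ ¬ Starved G D v then
      #(twoNbrs G v) + #(thinNbrs G v) + #(starvedNbrs G D v) else 0) +
    (if ¬ Stingy G D v then #(lightNbrs G v) else 0) := by
  refine (sum_le_sum_of_subset (subset_univ S)).trans (le_of_eq ?_)
  unfold gift
  simp only [sum_add_distrib, and_assoc, ite_and, sum_ite_mem, univ_inter, sum_const, smul_eq_mul]
  split_ifs <;> simp

lemma Critical.lt_nbrDegSum (h : Critical G D) (hv : 1 ≤ #(leafNbrs G v)) :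
    3 * D + 1 ≤ nbrDegSum G v := by
  obtain ⟨u, hu⟩ := card_pos.1 hv
  obtain ⟨h1, h2⟩ := mem_leafNbrs.1 hu
  exact h.lt_nbrDegSum_of_leaf h2 h1

/-- A thin or light vertex has too small a degree sum for a bad neighbour. Hence a vertex of degree
two never lies between two vertices that are thin or starved. -/
lemma Critical.not_thin_not_light (h : Critical G D)
    (hu : 1 ≤ #(thinNbrs G v) + #(starvedNbrs G D v)) : ¬ Thin G v ∧ ¬ Light G v := by
  have hd := deg_eq_add (G := G) (v := v)
  have h1 := not_thin_not_light_of_bad h.seven_le (nbrDegSum_le h.deg_le) lightNbrs_card_le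
    (hd ▸ h.deg_le v) h.le_nbrDegSum_of_thinNbrs h.lt_nbrDegSum_of_starvedNbrs hu
  rwa [← hd] at h1

lemma nbrDegSum_le_of_deg (hdeg : ∀ x, deg G x ≤ D) : nbrDegSum G v ≤ deg G v * D := by
  rw [← smul_eq_mul]
  exact sum_le_card_nsmul (nbrs G v) (deg G) D fun x _ => hdeg x

lemma stingy_of_deg_eq_two (hdeg : ∀ x, deg G x ≤ D) (hv : deg G v = 2) : Stingy G D v := by
  have := nbrDegSum_le_of_deg (v := v) hdeg
  rw [hv] at this
  exact Or.inl ⟨by omega, by omega⟩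

lemma thin_of_deg_eq_two (hv : deg G v = 2) (hu : u ∈ twoNbrs G v) : Thin G v := by
  have := deg_eq_add (G := G) (v := v)
  have : 0 < #(twoNbrs G v) := card_pos.2 ⟨u, hu⟩
  constructor <;> omega

lemma Light.stingy (hdeg : ∀ x, deg G x ≤ D) (hv : Light G v) : Stingy G D v := by
  obtain ⟨h3, hbig, htwo⟩ := hv
  have h1 := nbrDegSum_le (v := v) hdeg
  have h2 := deg_eq_add (G := G) (v := v)
  refine Or.inl ⟨by omega, ?_⟩
  rw [hbig, htwo] at h1 h2
  have h3' : #(lightNbrs G v) ≤ 2 := hbig ▸ lightNbrs_card_le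
  have h4 : 3 ≤ D := h3 ▸ hdeg v
  interval_cases #(lightNbrs G v) <;> norm_num at h1 <;> omega

/-- A vertex of degree two receives enough charge and gives none. -/
lemma Critical.balance_of_deg_eq_two (h : Critical G D) {H : Finset V}
    (hH : ∀ v, v ∈ H ↔ 2 ≤ deg G v) (hv : deg G v = 2) :
    6 + ∑ u ∈ H, gift G D v u ≤
      2 * (#(bigNbrs G v) + #(twoNbrs G v)) + ∑ u ∈ H, gift G D u v := by
  have hp : #(leafNbrs G v) = 0 := by
    by_contra hp
    have h1 := h.lt_nbrDegSum (v := v) (by omega)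
    have h2 := nbrDegSum_le_of_deg (v := v) h.deg_le
    rw [hv] at h2
    have := h.seven_le
    omega
  have hd := deg_eq_add (G := G) (v := v)
  have hout : ∑ u ∈ H, gift G D v u = 0 := by
    refine sum_eq_zero fun u _ => ?_
    have h1 : Stingy G D v := stingy_of_deg_eq_two h.deg_le hv
    have h2 : u ∈ twoNbrs G v → Thin G v := thin_of_deg_eq_two hv
    have h3 : u ∈ thinNbrs G v → Thin G v := fun h => h2 (thinNbrs_subset h)
    have h4 : u ∈ starvedNbrs G D v → Thin G v := fun h => h2 (starvedNbrs_subset h)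
    unfold gift
    simp only [if_neg (show ¬ ((u ∈ twoNbrs G v ∧ ¬ Thin G v) ∧ ¬ Starved G D v) by tauto),
      if_neg (show ¬ ((u ∈ thinNbrs G v ∧ ¬ Thin G v) ∧ ¬ Starved G D v) by tauto),
      if_neg (show ¬ ((u ∈ starvedNbrs G D v ∧ ¬ Thin G v) ∧ ¬ Starved G D v) by tauto),
      if_neg (show ¬ (u ∈ lightNbrs G v ∧ ¬ Stingy G D v) by tauto), add_zero]
  obtain ⟨a, b, hab, hnv⟩ := card_eq_two.1 hv
  have hva : G.Adj v a := by rw [← mem_nbrs, hnv]; simp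
  have hvb : G.Adj v b := by rw [← mem_nbrs, hnv]; simp
  have hnotleaf : ∀ x, G.Adj v x → x ∈ H := fun x hx => by
    rw [hH]
    have h1 := deg_pos_of_adj hx.symm
    by_contra hlt
    have : x ∈ leafNbrs G v := by simp [hx]; omega
    rw [card_eq_zero.1 hp] at this
    simp at this
  have hgive : ∀ x, G.Adj v x → ¬ (Thin G x ∨ Starved G D x) → 1 ≤ gift G D x v := by
    intro x hx hpoor
    push Not at hpoor
    unfold gift
    rw [if_pos ⟨⟨mem_twoNbrs.2 ⟨hx.symm, hv⟩, hpoor.1⟩, hpoor.2⟩]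
    omega
  have hgive2 : ∀ x t, G.Adj v x → G.Adj v t → t ≠ x → (Thin G t ∨ Starved G D t) →
      2 ≤ gift G D x v := by
    intro x t hx ht htx hpoor
    have hmem : v ∈ thinNbrs G x ∨ v ∈ starvedNbrs G D x := by
      rw [mem_thinNbrs, mem_starvedNbrs]
      exact hpoor.imp (fun h => ⟨⟨hx.symm, hv⟩, t, ht, htx, h⟩)
        (fun h => ⟨⟨hx.symm, hv⟩, t, ht, htx, h⟩)
    have hpos : 1 ≤ #(thinNbrs G x) + #(starvedNbrs G D x) := by
      rcases hmem with hmem | hmem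
      · have := card_pos.2 ⟨v, hmem⟩
        omega
      · have := card_pos.2 ⟨v, hmem⟩
        omega
    obtain ⟨h1, h2⟩ := h.not_thin_not_light hpos
    have h3 : ¬ Starved G D x := fun h => h2 h.1
    unfold gift
    rw [if_pos ⟨⟨mem_twoNbrs.2 ⟨hx.symm, hv⟩, h1⟩, h3⟩]
    rcases hmem with hmem | hmem
    · rw [if_pos ⟨⟨hmem, h1⟩, h3⟩]
      omega
    · rw [if_pos (c := (v ∈ starvedNbrs G D x ∧ _) ∧ _) ⟨⟨hmem, h1⟩, h3⟩]
      omega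
  have hin : gift G D a v + gift G D b v ≤ ∑ u ∈ H, gift G D u v := by
    rw [← sum_pair (f := fun u => gift G D u v) hab]
    exact sum_le_sum_of_subset fun x hx => hnotleaf x (by
      rcases mem_insert.1 hx with rfl | hx
      · exact hva
      · exact mem_singleton.1 hx ▸ hvb)
  -- If one neighbour is thin or starved, the other pays 2; otherwise each pays 1.
  have htwo : 2 ≤ gift G D a v + gift G D b v := by
    by_cases ha : Thin G a ∨ Starved G D a
    · have := hgive2 b a hvb hva hab ha
      omega
    by_cases hb : Thin G b ∨ Starved G D b
    · have := hgive2 a b hva hvb hab.symm hb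
      omega
    have := hgive a hva ha
    have := hgive b hvb hb
    omega
  omega

lemma Critical.balance_of_three_le_deg (h : Critical G D) {H : Finset V}
    (hH : ∀ v, v ∈ H ↔ 2 ≤ deg G v) (hv : 3 ≤ deg G v) :
    6 + ∑ u ∈ H, gift G D v u ≤
      2 * (#(bigNbrs G v) + #(twoNbrs G v)) + ∑ u ∈ H, gift G D u v := by
  have hout := sum_gift_le (G := G) (D := D) (v := v) H
  have hd := deg_eq_add (G := G) (v := v)
  have hS := nbrDegSum_le (v := v) h.deg_le
  have har := lightNbrs_card_le (G := G) (v := v)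
  have hD := h.seven_le
  have hvD := h.deg_le v
  have hp := h.lt_nbrDegSum (v := v)
  have hb := h.le_nbrDegSum_of_thinNbrs (v := v)
  have hb' := h.lt_nbrDegSum_of_starvedNbrs (v := v)
  have hbt := card_thinNbrs_add_card_starvedNbrs_le (G := G) (D := D) (v := v)
  by_cases hthin : Thin G v
  · have h1 := charge_of_thin hD (hd ▸ hv) hS har (hd ▸ hthin.2) hp hthin.1
    have hst : Stingy G D v := Or.inl ⟨hthin.2, h1.2⟩
    rw [if_neg (by tauto), if_neg (by tauto)] at hout
    omega
  by_cases hlight : Light G v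
  · have hst := hlight.stingy h.deg_le
    have h0 : ¬ 1 ≤ #(thinNbrs G v) + #(starvedNbrs G D v) := fun h0 =>
      (h.not_thin_not_light h0).2 hlight
    have hbig := hlight.2.1
    have htwo := hlight.2.2
    by_cases hstarved : Starved G D v
    · rw [if_neg (by tauto), if_neg (by tauto)] at hout
      omega
    · rw [if_pos ⟨hthin, hstarved⟩, if_neg (by tauto)] at hout
      have : ∃ y ∈ bigNbrs G v, ¬ Stingy G D y := by
        by_contra! hall
        exact hstarved ⟨hlight, hall⟩
      obtain ⟨y, hy, hys⟩ := this
      rw [mem_bigNbrs] at hy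
      have h1 : 1 ≤ gift G D y v := by
        unfold gift
        rw [if_pos (c := v ∈ lightNbrs G y ∧ _) ⟨mem_lightNbrs.2 ⟨hy.1.symm, hlight⟩, hys⟩]
        omega
      have h2 : gift G D y v ≤ ∑ u ∈ H, gift G D u v :=
        single_le_sum (f := fun u => gift G D u v) (fun _ _ => Nat.zero_le _)
          ((hH y).2 (by omega))
      omega
  · have hthin' : ¬ (#(bigNbrs G v) ≤ 1 ∧
        #(leafNbrs G v) + #(twoNbrs G v) + #(bigNbrs G v) ≤ 5) := by rwa [← hd]
    have hlight' : ¬ (#(leafNbrs G v) + #(twoNbrs G v) + #(bigNbrs G v) = 3 ∧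
        #(bigNbrs G v) = 2 ∧ #(twoNbrs G v) = 1) := by rwa [← hd]
    rw [if_pos ⟨hthin, fun hs => hlight hs.1⟩] at hout
    by_cases hst : Stingy G D v
    · rw [if_neg (by tauto)] at hout
      have := charge_of_stingy hD (hd ▸ hv) hS har (hd ▸ hvD) hp hb hb' hbt hthin' hlight'
      omega
    · rw [if_pos hst] at hout
      have hst' := hst
      rw [Stingy, not_or] at hst'
      have hfull : #(bigNbrs G v) = 3 → #(lightNbrs G v) = 1 →
          #(thinNbrs G v) < #(twoNbrs G v) := fun h1 h2 => by
        refine card_lt_card (thinNbrs_subset.ssubset_of_not_subset fun h3 => hst'.2 ⟨h1, h2, h3⟩)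
      have := charge_of_not_stingy hD (hd ▸ hv) hS har (hd ▸ hvD) hp hb hb' hbt hthin' hlight'
        (hd ▸ hst'.1) hfull
      omega

/-- Double counting of incidences, each edge having at most two ends in `H`. -/
lemma sum_card_nbrs_filter_le (H : Finset V) : ∑ v ∈ H, #((nbrs G v).filter (· ∈ H)) ≤
    2 * #((edges G).filter fun e => ∀ x ∈ e, x ∈ H) := by
  set E := (edges G).filter fun e => ∀ x ∈ e, x ∈ H with hE
  calc ∑ v ∈ H, #((nbrs G v).filter (· ∈ H)) ≤ ∑ v ∈ H, #(E.filter fun e => v ∈ e) := by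
        refine sum_le_sum fun v hv => card_le_card_of_injOn (s(v, ·)) (fun y hy => ?_) ?_
        · simp only [coe_filter, mem_nbrs, Set.mem_ofPred_eq] at hy
          simp [hE, hy.1, hv, hy.2]
        · intro y _ z _ hyz
          exact Sym2.congr_right.1 hyz
    _ = ∑ e ∈ E, #(H.filter fun v => v ∈ e) :=
        sum_card_bipartiteAbove_eq_sum_card_bipartiteBelow fun v e => v ∈ e
    _ ≤ ∑ e ∈ E, 2 := by
        refine sum_le_sum fun e _ => ?_
        induction e with
        | _ a b =>
          refine (card_le_card (t := {a, b}) fun x hx => ?_).trans card_le_two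
          simpa using (mem_filter.1 hx).2
    _ = 2 * #E := by rw [sum_const, smul_eq_mul, mul_comm]

lemma Critical.not_sparse (h : Critical G D) : ¬ Sparse G := by
  intro hsp
  set H : Finset V := univ.filter fun v => 2 ≤ deg G v with hHdef
  have hH : ∀ v, v ∈ H ↔ 2 ≤ deg G v := by simp [hHdef]
  have hne : H.Nonempty := by
    have hE : (edges G).Nonempty := by
      rw [nonempty_iff_ne_empty]
      intro hE
      refine h.not_colorable ⟨fun _ => ⟨0, by have := h.seven_le; omega⟩, ?_⟩
      rw [hE]
      exact ⟨by simp, by simp⟩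
    obtain ⟨e, he⟩ := hE
    induction e with
    | _ a b =>
      have hab := mem_edges.1 he
      by_cases ha : 2 ≤ deg G a
      · exact ⟨a, (hH a).2 ha⟩
      · have ha1 : deg G a = 1 := by
          have := deg_pos_of_adj hab
          omega
        have h1 := h.lt_nbrDegSum_of_leaf ha1 hab.symm
        have h2 := nbrDegSum_le_of_deg (v := b) h.deg_le
        refine ⟨b, (hH b).2 ?_⟩
        by_contra hlt
        have h3 : deg G b * D ≤ 1 * D := Nat.mul_le_mul_right D (by omega)
        omega
  have hsum : ∑ v ∈ H, (6 + ∑ u ∈ H, gift G D v u) ≤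
      ∑ v ∈ H, (2 * (#(bigNbrs G v) + #(twoNbrs G v)) + ∑ u ∈ H, gift G D u v) := by
    refine sum_le_sum fun v hv => ?_
    rcases ((hH v).1 hv).eq_or_lt' with hv | hv
    · exact h.balance_of_deg_eq_two hH hv
    · exact h.balance_of_three_le_deg hH hv
  have hcomm : ∑ v ∈ H, ∑ u ∈ H, gift G D v u = ∑ v ∈ H, ∑ u ∈ H, gift G D u v := sum_comm
  have hdegH : ∀ v, #(bigNbrs G v) + #(twoNbrs G v) = #((nbrs G v).filter (· ∈ H)) := by
    intro v
    rw [bigNbrs, twoNbrs, ← card_union_of_disjoint]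
    · congr 1
      ext x
      simp only [mem_union, mem_filter, hH]
      constructor
      · rintro (⟨h1, h2⟩ | ⟨h1, h2⟩) <;> exact ⟨h1, by omega⟩
      · rintro ⟨h1, h2⟩
        rcases h2.eq_or_lt' with h2 | h2
        · exact Or.inr ⟨h1, h2⟩
        · exact Or.inl ⟨h1, h2⟩
    · rw [disjoint_left]
      intro x hx hx'
      have := (mem_filter.1 hx).2
      have := (mem_filter.1 hx').2
      omega
  have h1 := sum_card_nbrs_filter_le (G := G) H
  have h2 := hsp H hne
  -- The gifts cancel by `hcomm`, leaving `6 * #H` at most twice the degree sum inside `H`, hence at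
  -- most four times the number of edges spanned by `H`.
  simp only [sum_add_distrib, ← mul_sum, hdegH, sum_const, smul_eq_mul] at hsum
  omega

end Discharging

/-! ### The upper bound for strong colourings, by induction on the number of edges. -/

section StrongColorings

variable {V : Type*} [Fintype V] {G : SimpleGraph V} {D k : ℕ}

lemma near_of_adj_lineGraph {e f : G.edgeSet} (h : G.lineGraph.Adj e f) :
    ∃ a, a ∈ (e : Sym2 V) ∧ a ∈ (f : Sym2 V) := by
  obtain ⟨-, a, ha⟩ := SimpleGraph.lineGraph_adj_iff_exists.1 h
  exact ⟨a, ha⟩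

lemma ColorableOn.strongChromaticIndex_le (h : ColorableOn G k (edges G)) :
    strongChromaticIndex G ≤ k := by
  obtain ⟨c, hc⟩ := h
  refine iInf₂_le k ⟨fun e => c e, fun e f hef hconf => ?_⟩
  refine hc.2 e (by simp [edges]) f (by simp [edges]) (fun h => hef (Subtype.ext h)) ?_
  rcases hconf with h | ⟨g, h1, h2⟩
  · obtain ⟨a, ha, hb⟩ := near_of_adj_lineGraph h
    exact ⟨a, ha, a, hb, Or.inl rfl⟩
  · obtain ⟨a, ha, hag⟩ := near_of_adj_lineGraph h1
    obtain ⟨b, hb, hbg⟩ := near_of_adj_lineGraph h2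
    refine ⟨a, ha, b, hb, ?_⟩
    by_cases hab : a = b
    · exact Or.inl hab
    · right
      have : (g : Sym2 V) = s(a, b) := ((Sym2.mem_and_mem_iff hab).1 ⟨hag, hbg⟩)
      rw [← SimpleGraph.mem_edgeSet, ← this]
      exact g.2

lemma colorableOn_edges_of_sparse (hD : 7 ≤ D) : ∀ (n : ℕ) (G : SimpleGraph V), #(edges G) = n →
    (∀ x, deg G x ≤ D) → Sparse G → ColorableOn G (3 * D) (edges G) := by
  intro n
  induction n using Nat.strong_induction_on with
  | _ n ih =>
    intro G hn hdeg hsp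
    by_contra hno
    refine Critical.not_sparse (G := G) (D := D) ⟨hD, hdeg, hno, fun u x hux => ?_⟩ hsp
    -- Isolating `u` loses no conflict between edges that avoid `u`: an edge joining two of them
    -- avoids `u` too. So a colouring of `G'` respects conflicts measured in `G`.
    obtain ⟨G', hG'⟩ : ∃ G' : SimpleGraph V, ∀ a b, G'.Adj a b ↔ G.Adj a b ∧ a ≠ u ∧ b ≠ u :=
      ⟨⟨fun a b => G.Adj a b ∧ a ≠ u ∧ b ≠ u, ⟨fun a b h => ⟨h.1.symm, h.2.2, h.2.1⟩⟩,
        ⟨fun a h => G.loopless.irrefl a h.1⟩⟩, fun _ _ => Iff.rfl⟩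
    have hE : edges G' = (edges G).filter (u ∉ ·) := by
      ext e
      induction e with
      | _ a b =>
        simp only [mem_edges, hG', mem_filter, Sym2.mem_iff, not_or]
        tauto
    have hsub : edges G' ⊆ edges G := hE ▸ filter_subset _ _
    have hlt : #(edges G') < n := by
      rw [← hn, hE]
      refine card_lt_card (filter_ssubset.2 ⟨s(u, x), by simpa, by simp⟩)
    obtain ⟨c, hc⟩ := ih _ hlt G' rfl
      (fun y => (card_le_card fun z hz => by
        rw [mem_nbrs, hG'] at hz
        simpa using hz.1).trans (hdeg y))
      (fun S hS => lt_of_le_of_lt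
        (Nat.mul_le_mul_left 2 (card_le_card (filter_subset_filter _ hsub))) (hsp S hS))
    refine ⟨c, filter_subset _ _, fun e he f hf hef hn => hc.2 e (hE ▸ he) f (hE ▸ hf) hef ?_⟩
    obtain ⟨a, ha, b, hb, h⟩ := hn
    refine ⟨a, ha, b, hb, h.imp_right fun h => (hG' a b).2 ⟨h, ?_, ?_⟩⟩
    · rintro rfl
      exact (mem_filter.1 he).2 ha
    · rintro rfl
      exact (mem_filter.1 hf).2 hb

lemma bddAbove_avgDegree (G : SimpleGraph V) : BddAbove (Set.range
    fun H : {H : G.Subgraph // H.verts.Nonempty} =>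
      2 * (H.1.edgeSet.ncard : ℝ) / (H.1.verts.ncard : ℝ)) :=
  (Set.finite_range _).bddAbove

lemma sparse_of_maxAvgDegree_lt (h : maxAvgDegree G < 3) : Sparse G := by
  intro S hS
  have h1 := (le_ciSup (bddAbove_avgDegree G)
    ⟨(⊤ : G.Subgraph).induce (S : Set V), by simpa using hS⟩).trans_lt h
  have hpos : (0 : ℝ) < #S := by exact_mod_cast hS.card_pos
  have hE : ((⊤ : G.Subgraph).induce (S : Set V)).edgeSet =
      ((edges G).filter fun e => ∀ x ∈ e, x ∈ S : Finset (Sym2 V)) := by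
    ext e
    induction e with
    | _ a b =>
      simp
      tauto
  simp only [SimpleGraph.Subgraph.induce_verts, hE, Set.ncard_coe_finset] at h1
  rw [div_lt_iff₀ hpos] at h1
  exact_mod_cast h1

lemma strongChromaticIndex_le_of_maxAvgDegree_lt [DecidableRel G.Adj] (hD : 7 ≤ D)
    (hG : maxAvgDegree G < 3) (hdeg : G.maxDegree ≤ D) :
    strongChromaticIndex G ≤ ((3 * D : ℕ) : ℕ∞) := by
  refine (colorableOn_edges_of_sparse hD _ G rfl (fun x => ?_)
    (sparse_of_maxAvgDegree_lt hG)).strongChromaticIndex_le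
  refine le_trans (le_of_eq ?_) ((G.degree_le_maxDegree x).trans hdeg)
  rw [← SimpleGraph.card_neighborFinset_eq_degree, deg]
  congr 1
  ext y
  simp

end StrongColorings

/-! ### Sharpness: the graph `K_Δ(4)`. -/

section Sharpness

variable {D t : ℕ}

@[simp] lemma cliqueWithPendants_inl_inl {i j : Fin t} :
    (cliqueWithPendants D t).Adj (Sum.inl i) (Sum.inl j) ↔ i ≠ j := by
  simp [cliqueWithPendants]

@[simp] lemma cliqueWithPendants_inl_inr {i : Fin t} {p : Fin t × Fin (D + 1 - t)} :
    (cliqueWithPendants D t).Adj (Sum.inl i) (Sum.inr p) ↔ i = p.1 := by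
  simp [cliqueWithPendants]

@[simp] lemma cliqueWithPendants_inr_inl {i : Fin t} {p : Fin t × Fin (D + 1 - t)} :
    (cliqueWithPendants D t).Adj (Sum.inr p) (Sum.inl i) ↔ i = p.1 := by
  simp [cliqueWithPendants]

@[simp] lemma cliqueWithPendants_inr_inr {p q : Fin t × Fin (D + 1 - t)} :
    ¬ (cliqueWithPendants D t).Adj (Sum.inr p) (Sum.inr q) := by
  simp [cliqueWithPendants]

lemma degree_cliqueWithPendants_inl (i : Fin t) :
    (cliqueWithPendants D t).degree (Sum.inl i) = t - 1 + (D + 1 - t) := by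
  rw [← SimpleGraph.card_neighborFinset_eq_degree]
  have : (cliqueWithPendants D t).neighborFinset (Sum.inl i) =
      (univ.erase i).disjSum ({i} ×ˢ univ) := by
    ext x
    rcases x with j | ⟨j, m⟩
    · simp [eq_comm]
    · simp [eq_comm]
  rw [this, card_disjSum, card_product]
  simp

lemma degree_cliqueWithPendants_inr (p : Fin t × Fin (D + 1 - t)) :
    (cliqueWithPendants D t).degree (Sum.inr p) = 1 := by
  rw [← SimpleGraph.card_neighborFinset_eq_degree, card_eq_one]
  refine ⟨Sum.inl p.1, ?_⟩
  ext x
  rcases x with j | q <;> simp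

lemma maxDegree_cliqueWithPendants_four (hD : 3 ≤ D) : (cliqueWithPendants D 4).maxDegree = D := by
  have hinl : ∀ i, (cliqueWithPendants D 4).degree (Sum.inl i) = D := fun i => by
    rw [degree_cliqueWithPendants_inl]
    omega
  refine le_antisymm (SimpleGraph.maxDegree_le_of_forall_degree_le _ _ fun x => ?_) ?_
  · rcases x with i | p
    · rw [hinl i]
    · rw [degree_cliqueWithPendants_inr]
      omega
  · conv_lhs => rw [← hinl 0]
    exact SimpleGraph.degree_le_maxDegree _ _

lemma card_edgeFinset_cliqueWithPendants_four (hD : 3 ≤ D) :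
    #(cliqueWithPendants D 4).edgeFinset = 4 * D - 6 := by
  have h := (cliqueWithPendants D 4).sum_degrees_eq_twice_card_edges
  simp only [Fintype.sum_sum_type, degree_cliqueWithPendants_inl, degree_cliqueWithPendants_inr,
    sum_const, card_univ, Fintype.card_prod, Fintype.card_fin, smul_eq_mul] at h
  omega

lemma exists_inl_mem {e : Sym2 (Fin t ⊕ Fin t × Fin (D + 1 - t))}
    (he : e ∈ (cliqueWithPendants D t).edgeSet) : ∃ i, Sum.inl i ∈ e := by
  induction e with
  | _ a b =>
    rcases a with i | p
    · exact ⟨i, by simp⟩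
    rcases b with j | q
    · exact ⟨j, by simp⟩
    · simp at he

/-- Any two edges of a clique with pendant edges are in conflict. -/
lemma IsStrongEdgeColoring.injective {α : Type*} {c : (cliqueWithPendants D t).edgeSet → α}
    (hc : IsStrongEdgeColoring (cliqueWithPendants D t) c) : Function.Injective c := by
  intro e f hef
  by_contra hne
  refine hc e f hne ?_ hef
  obtain ⟨i, hi⟩ := exists_inl_mem e.2
  obtain ⟨j, hj⟩ := exists_inl_mem f.2
  simp only [SimpleGraph.lineGraph_adj_iff_exists]
  by_cases hif : Sum.inl i ∈ f.1
  · exact Or.inl ⟨hne, _, hi, hif⟩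
  by_cases hje : Sum.inl j ∈ e.1
  · exact Or.inl ⟨hne, _, hje, hj⟩
  have hij : i ≠ j := fun h => hif (h ▸ hj)
  refine Or.inr ⟨⟨s(Sum.inl i, Sum.inl j), by simpa⟩, ⟨?_, _, hi, by simp⟩, ⟨?_, _, hj, by simp⟩⟩
  · rintro rfl
    simp at hje
  · rintro rfl
    simp at hif

lemma strongChromaticIndex_cliqueWithPendants_four (hD : 3 ≤ D) :
    strongChromaticIndex (cliqueWithPendants D 4) = ((4 * D - 6 : ℕ) : ℕ∞) := by
  have hcard : Fintype.card (cliqueWithPendants D 4).edgeSet = 4 * D - 6 := by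
    rw [← SimpleGraph.edgeFinset_card, card_edgeFinset_cliqueWithPendants_four hD]
  refine le_antisymm ?_ (le_iInf₂ fun k hk => ?_)
  · refine iInf₂_le (4 * D - 6) ⟨Fintype.equivFinOfCardEq hcard, fun e f hef _ h => ?_⟩
    exact hef ((Fintype.equivFinOfCardEq hcard).injective h)
  · obtain ⟨c, hc⟩ := hk
    have := Fintype.card_le_of_injective c hc.injective
    rw [hcard, Fintype.card_fin] at this
    exact_mod_cast this

/-- Each leaf in `S` accounts for at most one edge, and `s ≤ 4` clique vertices span at most `s * (s
- 1) / 2 ≤ 3 * s / 2` edges. -/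
lemma two_mul_card_le_of_cliqueWithPendants_four {S : Finset (Fin 4 ⊕ Fin 4 × Fin (D + 1 - 4))}
    {E : Finset (Sym2 (Fin 4 ⊕ Fin 4 × Fin (D + 1 - 4)))}
    (hE : ∀ e ∈ E, e ∈ (cliqueWithPendants D 4).edgeSet ∧ ∀ x ∈ e, x ∈ S) :
    2 * #E ≤ 3 * #S := by
  have hsub : E ⊆ (S.toLeft.offDiag.image fun p => s(Sum.inl p.1, Sum.inl p.2)) ∪
      S.toRight.image fun p => s(Sum.inl p.1, Sum.inr p) := by
    intro e he
    obtain ⟨hK, hS⟩ := hE e he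
    clear he
    induction e with
    | _ a b =>
      rw [SimpleGraph.mem_edgeSet] at hK
      have ha := hS a (by simp)
      have hb := hS b (by simp)
      simp only [mem_union, mem_image, mem_offDiag, mem_toLeft, mem_toRight]
      rcases a with i | p <;> rcases b with j | q
      · exact Or.inl ⟨(i, j), ⟨ha, hb, cliqueWithPendants_inl_inl.1 hK⟩, rfl⟩
      · exact Or.inr ⟨q, hb, by rw [cliqueWithPendants_inl_inr.1 hK]⟩
      · exact Or.inr ⟨p, ha, by rw [cliqueWithPendants_inr_inl.1 hK, Sym2.eq_swap]⟩
      · exact absurd hK cliqueWithPendants_inr_inr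
  have h1 : #(S.toLeft.offDiag.image fun p => (s(Sum.inl p.1, Sum.inl p.2) :
      Sym2 (Fin 4 ⊕ Fin 4 × Fin (D + 1 - 4)))) ≤ (#S.toLeft).choose 2 := by
    rw [← Sym2.card_image_offDiag]
    refine (card_le_card (t := ((S.toLeft.offDiag).image Sym2.mk.uncurry).image (Sym2.map Sum.inl))
      (fun e he => ?_)).trans card_image_le
    obtain ⟨p, hp, rfl⟩ := mem_image.1 he
    exact mem_image.2 ⟨s(p.1, p.2), mem_image.2 ⟨p, hp, rfl⟩, rfl⟩
  have h2 := card_le_card hsub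
  have h3 := card_union_le (S.toLeft.offDiag.image fun p => (s(Sum.inl p.1, Sum.inl p.2) :
    Sym2 (Fin 4 ⊕ Fin 4 × Fin (D + 1 - 4)))) (S.toRight.image fun p => s(Sum.inl p.1, Sum.inr p))
  have h4 := card_image_le (s := S.toRight) (f := fun p => (s(Sum.inl p.1, Sum.inr p) :
    Sym2 (Fin 4 ⊕ Fin 4 × Fin (D + 1 - 4))))
  have h5 := card_toLeft_add_card_toRight (u := S)
  have h6 : #S.toLeft ≤ 4 := by simpa using card_le_univ S.toLeft
  have h7 : 2 * (#S.toLeft).choose 2 ≤ 3 * #S.toLeft := by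
    interval_cases #S.toLeft <;> simp [Nat.choose]
  omega

lemma maxAvgDegree_cliqueWithPendants_four : maxAvgDegree (cliqueWithPendants D 4) = 3 := by
  have : Nonempty {H : (cliqueWithPendants D 4).Subgraph // H.verts.Nonempty} :=
    ⟨⟨⊤, ⟨Sum.inl 0, by simp⟩⟩⟩
  refine le_antisymm (ciSup_le fun ⟨H, hH⟩ => ?_) ?_
  · have hpos : 0 < H.verts.ncard := (Set.ncard_pos).2 hH
    rw [div_le_iff₀ (by exact_mod_cast hpos)]
    have hV : H.verts = (univ.filter (· ∈ H.verts) : Finset _) := by simp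
    have hE : H.edgeSet = (univ.filter (· ∈ H.edgeSet) : Finset _) := by simp
    rw [hV, hE, Set.ncard_coe_finset, Set.ncard_coe_finset]
    have := two_mul_card_le_of_cliqueWithPendants_four (S := univ.filter (· ∈ H.verts))
      (E := univ.filter (· ∈ H.edgeSet)) fun e he => by
        have he := (mem_filter.1 he).2
        exact ⟨H.edgeSet_subset he, fun x hx => by simpa using H.mem_verts_of_mem_edge he hx⟩
    exact_mod_cast this
  -- The clique itself, with 6 edges on 4 vertices, attains the value 3.
  · set H := (⊤ : (cliqueWithPendants D 4).Subgraph).induce (Set.range Sum.inl) with hHdef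
    refine le_trans ?_ (le_ciSup (bddAbove_avgDegree (cliqueWithPendants D 4))
      ⟨H, ⟨Sum.inl 0, 0, rfl⟩⟩)
    have hV : H.verts.ncard = 4 := by
      change (Set.range Sum.inl).ncard = 4
      rw [← Set.image_univ, Set.ncard_image_of_injective _ Sum.inl_injective, Set.ncard_univ]
      simp
    have hE : 6 ≤ H.edgeSet.ncard := by
      have h6 : #(((univ : Finset (Fin 4)).offDiag.image Sym2.mk.uncurry).image
          (Sym2.map (Sum.inl : _ → Fin 4 ⊕ Fin 4 × Fin (D + 1 - 4)))) = 6 := by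
        rw [card_image_of_injective _ (Sym2.map.injective Sum.inl_injective),
          Sym2.card_image_offDiag]
        simp [Nat.choose]
      rw [← h6, ← Set.ncard_coe_finset]
      refine Set.ncard_le_ncard (fun e he => ?_) (Set.toFinite _)
      simp only [coe_image, Set.mem_image, mem_coe, mem_offDiag] at he
      obtain ⟨_, ⟨⟨i, j⟩, ⟨-, -, hij⟩, rfl⟩, rfl⟩ := he
      simpa [hHdef] using hij
    simp only [hV]
    rw [le_div_iff₀ (by norm_num)]
    have : (6 : ℝ) ≤ H.edgeSet.ncard := by exact_mod_cast hE
    norm_num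
    linarith

end Sharpness

end StrongEdge

theorem theorem3 (Δ : ℕ) (hΔ : 7 ≤ Δ) :
    (∀ (V : Type*) [Fintype V] (G : SimpleGraph V) [DecidableRel G.Adj],
      StrongEdge.maxAvgDegree G < 3 → G.maxDegree ≤ Δ →
        StrongEdge.strongChromaticIndex G ≤ ((3 * Δ : ℕ) : ℕ∞)) ∧
    (StrongEdge.maxAvgDegree (StrongEdge.cliqueWithPendants Δ 4) = 3 ∧
      (StrongEdge.cliqueWithPendants Δ 4).maxDegree = Δ ∧
      StrongEdge.strongChromaticIndex (StrongEdge.cliqueWithPendants Δ 4) =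
        ((4 * Δ - 6 : ℕ) : ℕ∞) ∧
      ((3 * Δ : ℕ) : ℕ∞) <
        StrongEdge.strongChromaticIndex (StrongEdge.cliqueWithPendants Δ 4)) := by
  have hindex := StrongEdge.strongChromaticIndex_cliqueWithPendants_four (D := Δ) (by omega)
  refine ⟨fun V _ G _ hG hdeg => StrongEdge.strongChromaticIndex_le_of_maxAvgDegree_lt hΔ hG hdeg,
    StrongEdge.maxAvgDegree_cliqueWithPendants_four,
    StrongEdge.maxDegree_cliqueWithPendants_four (by omega), hindex, ?_⟩
  rw [hindex]
  exact_mod_cast (by omega : 3 * Δ < 4 * Δ - 6)
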